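/- Let $\lambda,P,T>0$ and let the path-loss exponent be $\eta=4$. Let the base stations (BSs) form a homogeneous Poisson point process $\Phi$ of intensity $\lambda$ in $\mathbb{R}^2$, seen from a test user at the origin; let $r_i$ be the distance of BS $i$ from the origin and let the channel power gains $h_i$ be i.i.d. exponential random variables with mean $1$, independent of $\Phi$. The user receives average power $P r_i^{-\eta}$ from BS $i$. The user is *best connected* if it is served by the BS with the largest average received power (the nearest BS), and it is *in blackout* if the nearest BS is skipped and it is served by the BS with the second largest average received power (the second nearest BS). In either case let $r_0$ denote the distance to the serving BS, and in the blackout case let $r_1<r_0$ denote the distance to the skipped BS and $h_1$ the gain of the skipped BS. Let $$I_r=\sum_{i\,:\,r_i>r_0}P\,h_i\,r_i^{-\eta},\qquad I_1=P\,h_1\,r_1^{-\eta}$$ be the interference from the BSs located outside the disc of radius $r_0$, and the interference from the skipped BS, and for $I\in\{I_r,I_1\}$ let $\mathscr{L}_{I}(s)=\mathbb{E}\left[e^{-sI}\mid r_0\right]$ be the Laplace transform conditional on $r_0$. Then, both in the best connected and in the blackout case, the series $I_r$ converges almost surely and, for almost every value of $r_0$, $$\mathscr{L}_{I_r}\!\left(\frac{T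 r_0^{4}}{P}\right)=\exp\!\left(-\pi\lambda r_0^{2}\sqrt{T}\arctan\sqrt{T}\right),$$ and in the blackout case, for almost every value of $r_0$, $$\mathscr{L}_{I_1}\!\left(\frac{T r_0^{4}}{P}\right)=1-\sqrt{T}\,\arctan\!\left(\frac{1}{\sqrt{T}}\right).$$ -/

import Mathlib

open MeasureTheory ProbabilityTheory

noncomputable section

/-- The plane in which the base stations (BSs) are located, with its Euclidean norm. The test user
is at the origin. -/
abbrev Plane : Type := EuclideanSpace ℝ (Fin 2)

/-- The number of points of the configuration `x` that lie in `A`, counted with multiplicity. -/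
def pointCount (x : ℕ → Plane) (A : Set Plane) : ℕ∞ :=
  Set.encard {i | x i ∈ A}

/-- The random points `X 0, X 1, …` of the plane (in any enumeration) form a Poisson point process
with intensity measure `Λ`: the number of points in a set of finite intensity is Poisson
distributed, and the numbers of points in pairwise disjoint sets are independent. -/
structure IsPoissonPointProcess {Ω : Type*} [MeasurableSpace Ω] (X : ℕ → Ω → Plane)
    (Λ : Measure Plane) (μ : Measure Ω) : Prop where
  measurable_point : ∀ i, Measurable (X i)
  poisson_count : ∀ A : Set Plane, MeasurableSet A → Λ A ≠ ⊤ → ∀ k : ℕ,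
    μ {ω | pointCount (fun i => X i ω) A = k} = poissonMeasure (Λ A).toNNReal {k}
  indep_count : ∀ (n : ℕ) (A : Fin n → Set Plane), (∀ j, MeasurableSet (A j)) →
    Pairwise (Function.onFun Disjoint A) →
    iIndepFun (fun (j : Fin n) (ω : Ω) => pointCount (fun i => X i ω) (A j)) μ

/-- A single-tier cellular network with Rayleigh fading: the BSs `X i` form a homogeneous Poisson
point process of intensity `lam` (per unit area), and their channel power gains `h i` to the test
user are i.i.d. exponential with mean one, independent of the BS locations. -/
structure IsRayleighPoissonNetwork {Ω : Type*} [MeasurableSpace Ω] (X : ℕ → Ω → Plane)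
    (h : ℕ → Ω → ℝ) (lam : ℝ) (μ : Measure Ω) : Prop where
  poisson : IsPoissonPointProcess X (ENNReal.ofReal lam • volume) μ
  gain_law : ∀ i, HasLaw (h i) (expMeasure 1) μ
  gain_indep : iIndepFun h μ
  gain_indep_points : IndepFun (fun ω i => X i ω) (fun ω i => h i ω) μ

/-- The distance from the test user to the BS with the random index `b`. -/
def bsDist {Ω : Type*} (X : ℕ → Ω → Plane) (b : Ω → ℕ) (ω : Ω) : ℝ :=
  ‖X (b ω) ω‖

/-- The average power `P r ^ (-η)` received at distance `r` from a BS with transmit power `P` and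
path loss exponent `η`. -/
def avgPower (P η r : ℝ) : ℝ := P * r ^ (-η)

/-- The test user is best connected: almost surely its serving BS `b₀` provides a larger average
received power than every other BS. -/
def IsBestConnected {Ω : Type*} [MeasurableSpace Ω] (P η : ℝ) (X : ℕ → Ω → Plane)
    (b₀ : Ω → ℕ) (μ : Measure Ω) : Prop :=
  Measurable b₀ ∧ ∀ᵐ ω ∂μ, ∀ i, i ≠ b₀ ω →
    avgPower P η ‖X i ω‖ < avgPower P η (bsDist X b₀ ω)

/-- The test user is in blackout, with serving BS `b₀` and skipped BS `b₁`: almost surely the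
average power received from `b₁` exceeds the one from `b₀`, which exceeds the one from every other
BS. -/
def IsBlackout {Ω : Type*} [MeasurableSpace Ω] (P η : ℝ) (X : ℕ → Ω → Plane)
    (b₀ b₁ : Ω → ℕ) (μ : Measure Ω) : Prop :=
  Measurable b₀ ∧ Measurable b₁ ∧ ∀ᵐ ω ∂μ,
    avgPower P η (bsDist X b₀ ω) < avgPower P η (bsDist X b₁ ω) ∧
    ∀ i, i ≠ b₀ ω → i ≠ b₁ ω → avgPower P η ‖X i ω‖ < avgPower P η (bsDist X b₀ ω)

/-- The contribution `P h_i r_i ^ (-η)` of BS `i` to the interference `outerInterference`: it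
counts only if the BS is located outside the disc of radius `r₀`. -/
def outerTerm {Ω : Type*} (P η : ℝ) (X : ℕ → Ω → Plane) (h : ℕ → Ω → ℝ)
    (r₀ : Ω → ℝ) (ω : Ω) (i : ℕ) : ℝ :=
  Set.indicator {j | r₀ ω < ‖X j ω‖} (fun j => avgPower P η ‖X j ω‖ * h j ω) i

/-- `I_r`: the interference from all the BSs located outside the disc of radius `r₀`. -/
def outerInterference {Ω : Type*} (P η : ℝ) (X : ℕ → Ω → Plane) (h : ℕ → Ω → ℝ)
    (r₀ : Ω → ℝ) (ω : Ω) : ℝ :=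
  ∑' i, outerTerm P η X h r₀ ω i

/-- `I_1`: the interference from the skipped BS `b₁`. -/
def skippedInterference {Ω : Type*} (P η : ℝ) (X : ℕ → Ω → Plane) (h : ℕ → Ω → ℝ)
    (b₁ : Ω → ℕ) (ω : Ω) : ℝ :=
  avgPower P η (bsDist X b₁ ω) * h (b₁ ω) ω

/-- The Laplace transform at `s` of the conditional law of `I` given `r₀ = ρ`. -/
def condLaplace {Ω : Type*} [MeasurableSpace Ω] (I r₀ : Ω → ℝ) (μ : Measure Ω)
    [IsFiniteMeasure μ] (s ρ : ℝ) : ℝ :=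
  ∫ x, Real.exp (-(s * x)) ∂(condDistrib I r₀ μ ρ)

end

/-! ### Counts, moments and intensity of the Poisson process. -/

section PointCount

variable {Ω : Type*} [MeasurableSpace Ω] {X : ℕ → Ω → Plane} {Λ : Measure Plane} {μ : Measure Ω}

/-! Write R for the distance to the serving point. A conditional Laplace transform given R is
determined by the integrals of exp(-s(R) I) over the events {R ∈ B}; `ae_condLaplace_eq` reduces the
theorem to computing these. Being independent of the points, the exponential gains integrate out,
each weight c contributing a factor 1/(1 + c) = exp(-log(1 + c)) (`setIntegral_exp_neg_tsum_gains`).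
What remains concerns the point configuration alone.

For the outer interference, the remaining factor is a Poisson Laplace functional with test function
log(1 + w), except that w is cut off at the random radius R. Since R is the first or second smallest
distance, {R ≤ a} says that the closed disc of radius a holds more than 0 or 1 points. For a ≤ s,
this count is independent of the points beyond a fixed radius s, so on {r < R ≤ s} the functional
with cutoff s takes its unconditional value (`laplace_functional`, an exact identity). Letting the
cells shrink to R (`setIntegral_eq_of_cells`) replaces s by R. With b = √T r², the exponent is λ
times the planar integral of b² / (‖x‖⁴ + b²) over ‖x‖ > r, an arctangent in polar coordinates.

For the skipped interference, the event that the second nearest point lies beyond r and the nearest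
lies in A ⊆ disc(r) means one point in A and none in the rest of the disc; its probability is Λ(A)
exp(-Λ(disc(r))). Differences in r show that, on {r < R ≤ s} and given that it falls in disc(r), the
nearest point is uniform there. Averaging 1 / (1 + T r⁴/‖x‖⁴) over the disc gives 1 - √T
arctan(1/√T), and shrinking cells again passes to R. -/

theorem measurable_pointCount (hX : ∀ i, Measurable (X i)) {A : Set Plane} (hA : MeasurableSet A) :
    Measurable fun ω => pointCount (fun i => X i ω) A := by
  refine measurable_encard.comp (measurable_set_iff.2 fun i => ?_)
  exact measurableSet_setOfPred.1 (hX i hA)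

theorem finite_of_pointCount_ne_top {x : ℕ → Plane} {A : Set Plane} (h : pointCount x A ≠ ⊤) :
    {i | x i ∈ A}.Finite :=
  Set.encard_ne_top_iff.1 h

theorem hasSum_indicator_pointCount {x : ℕ → Plane} {A : Set Plane} (h : pointCount x A ≠ ⊤)
    (c : ℝ) : HasSum (fun i => A.indicator (fun _ => c) (x i)) ((pointCount x A).toNat * c) := by
  have hf := finite_of_pointCount_ne_top h
  have h1 : ∀ i ∉ hf.toFinset, A.indicator (fun _ => c) (x i) = 0 := by
    intro i hi
    have : x i ∉ A := by simpa using hi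
    simp [this]
  have h2 : HasSum (fun i => A.indicator (fun _ => c) (x i)) _ :=
    hasSum_sum_of_ne_finset_zero h1
  have h3 : ∑ i ∈ hf.toFinset, A.indicator (fun _ => c) (x i) = (pointCount x A).toNat * c := by
    rw [Finset.sum_congr rfl (g := fun _ => c)]
    · rw [Finset.sum_const, nsmul_eq_mul]
      congr 2
      rw [pointCount, hf.encard_eq_coe_toFinset_card, ENat.toNat_natCast]
    · intro i hi
      have : x i ∈ A := by simpa using hi
      simp [this]
  rwa [h3] at h2

theorem IsPoissonPointProcess.isProbabilityMeasure (hX : IsPoissonPointProcess X Λ μ) :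
    IsProbabilityMeasure μ :=
  (hX.indep_count 0 (fun _ => ∅) (fun _ => .empty) (fun i => i.elim0)).isProbabilityMeasure

/-- The Poisson probabilities of the finite values already sum to 1, which leaves no mass for ⊤. -/
theorem IsPoissonPointProcess.ae_pointCount_ne_top (hX : IsPoissonPointProcess X Λ μ)
    {A : Set Plane} (hA : MeasurableSet A) (hΛ : Λ A ≠ ⊤) :
    ∀ᵐ ω ∂μ, pointCount (fun i => X i ω) A ≠ ⊤ := by
  have := hX.isProbabilityMeasure
  have hm := measurable_pointCount hX.measurable_point hA
  have hs : {ω | pointCount (fun i => X i ω) A ≠ ⊤} =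
      ⋃ k : ℕ, {ω | pointCount (fun i => X i ω) A = k} := by
    ext ω
    simp only [Set.mem_ofPred_eq, Set.mem_iUnion, ENat.ne_top_iff_exists]
    exact exists_congr fun _ => eq_comm
  have hk : ∀ k : ℕ, MeasurableSet {ω | pointCount (fun i => X i ω) A = k} :=
    fun k => hm (measurableSet_singleton _)
  have hmeas : MeasurableSet {ω | pointCount (fun i => X i ω) A ≠ ⊤} :=
    hs ▸ MeasurableSet.iUnion hk
  change {ω | pointCount (fun i => X i ω) A ≠ ⊤} ∈ ae μ
  rw [mem_ae_iff_prob_eq_one hmeas, hs, measure_iUnion _ hk]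
  · simp_rw [hX.poisson_count A hA hΛ]
    rw [← measure_iUnion (fun i j hij => Set.disjoint_singleton.2 hij)
      fun _ => measurableSet_singleton _, Set.iUnion_of_singleton]
    exact measure_univ
  · intro i j hij
    refine Set.disjoint_left.2 fun ω h1 h2 => hij ?_
    simp only [Set.mem_ofPred_eq] at h1 h2
    exact_mod_cast h1.symm.trans h2

theorem IsPoissonPointProcess.map_toNat_pointCount (hX : IsPoissonPointProcess X Λ μ)
    {A : Set Plane} (hA : MeasurableSet A) (hΛ : Λ A ≠ ⊤) :
    μ.map (fun ω => (pointCount (fun i => X i ω) A).toNat) = poissonMeasure (Λ A).toNNReal := by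
  have hm := measurable_pointCount hX.measurable_point hA
  have hm' : Measurable fun ω => (pointCount (fun i => X i ω) A).toNat :=
    Measurable.of_discrete.comp hm
  refine Measure.ext_of_singleton fun k => ?_
  rw [Measure.map_apply hm' (measurableSet_singleton _), ← hX.poisson_count A hA hΛ k]
  refine measure_congr ?_
  filter_upwards [hX.ae_pointCount_ne_top hA hΛ] with ω hω
  refine propext ?_
  change (pointCount (fun i => X i ω) A).toNat = k ↔ pointCount (fun i => X i ω) A = k
  obtain ⟨n, hn⟩ := ENat.ne_top_iff_exists.1 hω
  rw [← hn]; simp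

theorem integral_exp_neg_poissonMeasure (r : NNReal) (t : ℝ) :
    ∫ n : ℕ, Real.exp (-(n * t)) ∂poissonMeasure r =
      Real.exp (-(r * (1 - Real.exp (-t)))) := by
  rw [integral_poissonMeasure]
  have h := (NormedSpace.expSeries_div_hasSum_exp (r * Real.exp (-t) : ℝ)).mul_left
    (Real.exp (-r))
  rw [← Real.exp_eq_exp_ℝ, ← Real.exp_add] at h
  rw [show -((r : ℝ) * (1 - Real.exp (-t))) = -r + r * Real.exp (-t) by ring, ← h.tsum_eq]
  refine tsum_congr fun n => ?_
  rw [mul_pow, ← Real.exp_nat_mul, smul_eq_mul, mul_neg]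
  ring

theorem IsPoissonPointProcess.integral_exp_neg_pointCount (hX : IsPoissonPointProcess X Λ μ)
    {A : Set Plane} (hA : MeasurableSet A) (hΛ : Λ A ≠ ⊤) (t : ℝ) :
    ∫ ω, Real.exp (-((pointCount (fun i => X i ω) A).toNat * t)) ∂μ =
      Real.exp (-(Λ.real A * (1 - Real.exp (-t)))) := by
  have hm' : Measurable fun ω => (pointCount (fun i => X i ω) A).toNat :=
    Measurable.of_discrete.comp (measurable_pointCount hX.measurable_point hA)
  have h := integral_exp_neg_poissonMeasure (Λ A).toNNReal t
  rw [← hX.map_toNat_pointCount hA hΛ, integral_map hm'.aemeasurable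
    Measurable.of_discrete.aestronglyMeasurable] at h
  exact h

theorem lintegral_natCast_poissonMeasure (r : NNReal) :
    ∫⁻ n : ℕ, (n : ENNReal) ∂poissonMeasure r = r := by
  have h1 : ∀ n : ℕ, ENNReal.ofReal (Real.exp (-r) * r ^ (n + 1) / (n + 1).factorial) *
      ((n + 1 : ℕ) : ENNReal) = r * poissonMeasure r {n} := by
    intro n
    rw [poissonMeasure_singleton, ← ENNReal.ofReal_natCast, ← ENNReal.ofReal_coe_nnreal,
      ← ENNReal.ofReal_mul (by positivity), ← ENNReal.ofReal_mul (by positivity)]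
    congr 1
    rw [Nat.factorial_succ]
    push_cast
    field_simp
    ring
  rw [poissonMeasure, lintegral_sum_measure]
  simp only [lintegral_smul_measure, lintegral_dirac, smul_eq_mul]
  rw [tsum_eq_zero_add' ENNReal.summable]
  simp only [h1, Nat.cast_zero, mul_zero, zero_add]
  rw [ENNReal.tsum_mul_left, ← measure_iUnion (fun i j hij => Set.disjoint_singleton.2 hij)
      fun _ => measurableSet_singleton _, Set.iUnion_of_singleton, measure_univ, mul_one]

theorem pointCount_toENNReal (x : ℕ → Plane) (A : Set Plane) :
    (pointCount x A : ENNReal) = ∑' i, A.indicator (fun _ => (1 : ENNReal)) (x i) := by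
  have h := Measure.count_apply (s := {i | x i ∈ A}) (by measurability)
  rw [pointCount, ← h, Measure.count, Measure.sum_apply _ (by measurability)]
  refine tsum_congr fun i => ?_
  rw [Measure.dirac_apply' _ (by measurability)]
  rfl

theorem IsPoissonPointProcess.tsum_measure_preimage (hX : IsPoissonPointProcess X Λ μ)
    {A : Set Plane} (hA : MeasurableSet A) (hΛ : Λ A ≠ ⊤) :
    ∑' i, μ (X i ⁻¹' A) = Λ A := by
  have hm' : Measurable fun ω => (pointCount (fun i => X i ω) A).toNat :=
    Measurable.of_discrete.comp (measurable_pointCount hX.measurable_point hA)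
  have h := lintegral_natCast_poissonMeasure (Λ A).toNNReal
  rw [← hX.map_toNat_pointCount hA hΛ, lintegral_map Measurable.of_discrete hm',
    ENNReal.coe_toNNReal hΛ] at h
  rw [← h]
  have h2 : ∀ᵐ ω ∂μ, ((pointCount (fun i => X i ω) A).toNat : ENNReal) =
      ∑' i, A.indicator (fun _ => (1 : ENNReal)) (X i ω) := by
    filter_upwards [hX.ae_pointCount_ne_top hA hΛ] with ω hω
    rw [← pointCount_toENNReal]
    conv_rhs => rw [← ENat.natCast_toNat hω]
    simp
  rw [lintegral_congr_ae h2, lintegral_tsum]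
  · refine tsum_congr fun i => ?_
    rw [← lintegral_indicator_one (hX.measurable_point i hA)]
    rfl
  · exact fun i => ((measurable_const.indicator hA).comp (hX.measurable_point i)).aemeasurable

/-- The mean of the Poisson count identifies the two measures on sets of finite intensity;
exhausting the plane by balls extends this to all measurable sets. -/
theorem IsPoissonPointProcess.sum_map_eq [IsFiniteMeasureOnCompacts Λ]
    (hX : IsPoissonPointProcess X Λ μ) : Measure.sum (fun i => μ.map (X i)) = Λ := by
  have hfin : ∀ A : Set Plane, MeasurableSet A → Λ A ≠ ⊤ →
      Measure.sum (fun i => μ.map (X i)) A = Λ A := by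
    intro A hA hΛ
    rw [Measure.sum_apply _ hA, ← hX.tsum_measure_preimage hA hΛ]
    exact tsum_congr fun i => Measure.map_apply (hX.measurable_point i) hA
  ext A hA
  have hU : A = ⋃ n : ℕ, A ∩ Metric.closedBall 0 n := by
    rw [← Set.inter_iUnion, Metric.iUnion_closedBall_nat, Set.inter_univ]
  have hmono : Monotone fun n : ℕ => A ∩ Metric.closedBall (0 : Plane) n := fun m n hmn =>
    Set.inter_subset_inter_right _ (Metric.closedBall_subset_closedBall (by exact_mod_cast hmn))
  rw [hU, hmono.measure_iUnion, hmono.measure_iUnion]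
  refine iSup_congr fun n => hfin _ (hA.inter measurableSet_closedBall) ?_
  exact ne_top_of_le_ne_top (isCompact_closedBall _ _).measure_ne_top
    (measure_mono Set.inter_subset_right)

/-- Campbell's formula. -/
theorem IsPoissonPointProcess.tsum_lintegral [IsFiniteMeasureOnCompacts Λ]
    (hX : IsPoissonPointProcess X Λ μ) {f : Plane → ENNReal} (hf : Measurable f) :
    ∑' i, ∫⁻ ω, f (X i ω) ∂μ = ∫⁻ x, f x ∂Λ := by
  rw [← hX.sum_map_eq, lintegral_sum_measure]
  exact tsum_congr fun i => (lintegral_map hf (hX.measurable_point i)).symm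

theorem IsPoissonPointProcess.ae_forall_notMem [IsFiniteMeasureOnCompacts Λ]
    (hX : IsPoissonPointProcess X Λ μ) {A : Set Plane} (hA : MeasurableSet A) (h0 : Λ A = 0) :
    ∀ᵐ ω ∂μ, ∀ i, X i ω ∉ A := by
  rw [ae_all_iff]
  intro i
  have h := hX.tsum_measure_preimage hA (by simp [h0])
  rw [h0, ENNReal.tsum_eq_zero] at h
  exact measure_eq_zero_iff_ae_notMem.1 (h i)

end PointCount

/-! ### The Laplace functional jointly with a count. -/

section LaplaceFunctional

open Filter Topology

/-- The step function with value `t j` on the cell `A j`. -/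
noncomputable def stepFun {n : ℕ} (A : Fin n → Set Plane) (t : Fin n → ℝ) (x : Plane) : ℝ :=
  ∑ j, (A j).indicator (fun _ => t j) x

theorem stepFun_of_mem {n : ℕ} {A : Fin n → Set Plane} (t : Fin n → ℝ)
    (hA : Pairwise (Function.onFun Disjoint A)) {x : Plane} {j : Fin n} (hx : x ∈ A j) :
    stepFun A t x = t j := by
  rw [stepFun, Finset.sum_eq_single j]
  · simp [hx]
  · intro k _ hk
    exact Set.indicator_of_notMem (fun h => Set.disjoint_left.1 (hA hk) h hx) _
  · simp

theorem stepFun_of_notMem {n : ℕ} {A : Fin n → Set Plane} (t : Fin n → ℝ) {x : Plane}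
    (hx : ∀ j, x ∉ A j) : stepFun A t x = 0 :=
  Finset.sum_eq_zero fun j _ => Set.indicator_of_notMem (hx j) _

theorem one_sub_exp_neg_stepFun {n : ℕ} {A : Fin n → Set Plane} (t : Fin n → ℝ)
    (hA : Pairwise (Function.onFun Disjoint A)) (x : Plane) :
    1 - Real.exp (-stepFun A t x) = stepFun A (fun j => 1 - Real.exp (-t j)) x := by
  by_cases h : ∃ j, x ∈ A j
  · obtain ⟨j, hj⟩ := h
    rw [stepFun_of_mem t hA hj, stepFun_of_mem _ hA hj]
  · push Not at h
    rw [stepFun_of_notMem t h, stepFun_of_notMem _ h]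
    simp

theorem measurable_stepFun {n : ℕ} {A : Fin n → Set Plane} (t : Fin n → ℝ)
    (hA : ∀ j, MeasurableSet (A j)) : Measurable (stepFun A t) :=
  Finset.measurable_fun_sum _ fun j _ => measurable_const.indicator (hA j)

variable {Ω : Type*} [MeasurableSpace Ω] {X : ℕ → Ω → Plane} {Λ : Measure Plane} {μ : Measure Ω}

/-- On disjoint cells the exponential factors over independent Poisson counts, and each factor is a
Poisson Laplace transform. The set `D` may have infinite intensity, since only independence of its
count is used. -/
theorem IsPoissonPointProcess.laplace_stepFun (hX : IsPoissonPointProcess X Λ μ)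
    {D : Set Plane} (hD : MeasurableSet D) (S : Set ℕ∞) {n : ℕ} {A : Fin n → Set Plane}
    (t : Fin n → ℝ) (hAm : ∀ j, MeasurableSet (A j)) (hAΛ : ∀ j, Λ (A j) ≠ ⊤)
    (hA : Pairwise (Function.onFun Disjoint A)) (hDA : ∀ j, Disjoint D (A j)) :
    ∫ ω, S.indicator (fun _ => (1 : ℝ)) (pointCount (fun i => X i ω) D) *
        Real.exp (-∑' i, stepFun A t (X i ω)) ∂μ =
      μ.real {ω | pointCount (fun i => X i ω) D ∈ S} *
        Real.exp (-∫ x, (1 - Real.exp (-stepFun A t x)) ∂Λ) := by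
  -- Adjoining `D` as cell 0, with the indicator of `S` as its factor, lets one product formula
  -- treat the event and the exponential together.
  set B : Fin (n + 1) → Set Plane := Fin.cons D A with hB
  set f : Fin (n + 1) → ℕ∞ → ℝ :=
    Fin.cons (S.indicator fun _ => 1) (fun j k => Real.exp (-(k.toNat * t j))) with hf
  have hBm : ∀ j, MeasurableSet (B j) := by
    intro j; refine Fin.cases ?_ (fun j => ?_) j
    · exact hD
    · exact hAm j
  have hBd : Pairwise (Function.onFun Disjoint B) := by
    intro i j
    refine Fin.cases ?_ (fun i => ?_) i <;> refine Fin.cases ?_ (fun j => ?_) j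
    · simp
    · intro _; exact hDA j
    · intro _; exact (hDA i).symm
    · intro h; exact hA fun h' => h (congrArg Fin.succ h')
  have key := (hX.indep_count (n + 1) B hBm hBd).integral_fun_prod_comp (f := f)
    (fun j => (measurable_pointCount hX.measurable_point (hBm j)).aemeasurable)
    (fun j => Measurable.of_discrete.aestronglyMeasurable)
  simp only [Fin.prod_univ_succ] at key
  simp only [hB, hf, Fin.cons_zero, Fin.cons_succ] at key
  simp only [hX.integral_exp_neg_pointCount (hAm _) (hAΛ _)] at key
  have hfin : ∀ᵐ ω ∂μ, ∀ j, pointCount (fun i => X i ω) (A j) ≠ ⊤ :=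
    ae_all_iff.2 fun j => hX.ae_pointCount_ne_top (hAm j) (hAΛ j)
  convert key using 1
  · refine integral_congr_ae ?_
    filter_upwards [hfin] with ω hω
    have : HasSum (fun i => stepFun A t (X i ω))
        (∑ j, (pointCount (fun i => X i ω) (A j)).toNat * t j) :=
      hasSum_sum fun j _ => hasSum_indicator_pointCount (hω j) (t j)
    rw [this.tsum_eq, ← Finset.sum_neg_distrib, Real.exp_sum]
  · congr 1
    · rw [← integral_indicator_one]
      · rfl
      · exact measurable_pointCount hX.measurable_point hD (MeasurableSet.of_discrete (s := S))
    · rw [← Real.exp_sum, Finset.sum_neg_distrib]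
      congr 2
      simp_rw [one_sub_exp_neg_stepFun t hA, stepFun]
      rw [integral_finsetSum]
      · refine Finset.sum_congr rfl fun j _ => ?_
        rw [integral_indicator_const _ (hAm j), smul_eq_mul]
      · exact fun j _ => (integrable_indicator_iff (hAm j)).2 (integrableOn_const (hAΛ j))

/-- The cells of a discretization of `f` at scale `1 / (n + 1)`. -/
noncomputable def levelCell (f : Plane → ℝ) (n : ℕ) (j : Fin ((n + 1) ^ 2)) : Set Plane :=
  Metric.closedBall 0 n ∩ {x | ⌊((n + 1 : ℕ) : ℝ) * f x⌋₊ = (j : ℕ) + 1}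

/-- A discretization of `f` at scale `1 / (n + 1)`. -/
noncomputable def levelApprox (f : Plane → ℝ) (n : ℕ) : Plane → ℝ :=
  stepFun (levelCell f n) fun j => ((j : ℕ) + 1) / ((n + 1 : ℕ) : ℝ)

theorem pairwise_disjoint_levelCell (f : Plane → ℝ) (n : ℕ) :
    Pairwise (Function.onFun Disjoint (levelCell f n)) := by
  intro i j hij
  refine Set.disjoint_left.2 fun x hi hj => hij ?_
  have := hi.2.symm.trans hj.2
  exact Fin.ext (by omega)

theorem measurableSet_levelCell {f : Plane → ℝ} (hf : Measurable f) (n : ℕ) (j) :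
    MeasurableSet (levelCell f n j) :=
  measurableSet_closedBall.inter
    ((Nat.measurable_floor.comp (hf.const_mul _)) (measurableSet_singleton _))

theorem levelApprox_eq_zero_or (f : Plane → ℝ) (n : ℕ) (x : Plane) :
    levelApprox f n x = 0 ∨
      levelApprox f n x = ⌊((n + 1 : ℕ) : ℝ) * f x⌋₊ / ((n + 1 : ℕ) : ℝ) := by
  by_cases h : ∃ j, x ∈ levelCell f n j
  · obtain ⟨j, hj⟩ := h
    right
    rw [levelApprox, stepFun_of_mem _ (pairwise_disjoint_levelCell f n) hj, hj.2]
    push_cast; rfl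
  · push Not at h
    exact Or.inl (stepFun_of_notMem _ h)

theorem levelApprox_nonneg (f : Plane → ℝ) (n : ℕ) (x : Plane) : 0 ≤ levelApprox f n x := by
  rcases levelApprox_eq_zero_or f n x with h | h <;> rw [h]
  positivity

theorem levelApprox_le {f : Plane → ℝ} (n : ℕ) {x : Plane} (hx : 0 ≤ f x) :
    levelApprox f n x ≤ f x := by
  rcases levelApprox_eq_zero_or f n x with h | h <;> rw [h]
  · exact hx
  · rw [div_le_iff₀ (by positivity), mul_comm (f x)]
    exact Nat.floor_le (by positivity)

theorem levelApprox_eq {f : Plane → ℝ} {n : ℕ} {x : Plane} (hx : ‖x‖ ≤ n) (hfx : f x ≤ n) :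
    levelApprox f n x = ⌊((n + 1 : ℕ) : ℝ) * f x⌋₊ / ((n + 1 : ℕ) : ℝ) := by
  by_cases h0 : ⌊((n + 1 : ℕ) : ℝ) * f x⌋₊ = 0
  · rw [h0]
    rcases levelApprox_eq_zero_or f n x with h | h
    · simpa using h
    · rw [h, h0]
  · have hle : ⌊((n + 1 : ℕ) : ℝ) * f x⌋₊ ≤ (n + 1) ^ 2 := by
      refine Nat.floor_le_of_le ?_
      push_cast
      nlinarith
    have hmem : x ∈ levelCell f n ⟨⌊((n + 1 : ℕ) : ℝ) * f x⌋₊ - 1, by omega⟩ :=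
      ⟨by simpa using hx, by change _ = _ - 1 + 1; omega⟩
    rw [levelApprox, stepFun_of_mem _ (pairwise_disjoint_levelCell f n) hmem]
    congr 1
    rw [← Nat.cast_add_one]
    congr 1
    change _ - 1 + 1 = _
    omega

theorem tendsto_levelApprox {f : Plane → ℝ} {x : Plane} (hx : 0 ≤ f x) :
    Tendsto (fun n => levelApprox f n x) atTop (𝓝 (f x)) := by
  have h := (tendsto_nat_floor_mul_div_atTop hx).comp
    (tendsto_natCast_atTop_atTop.comp (tendsto_add_atTop_nat 1))
  have h' : Tendsto (fun n : ℕ => (⌊((n + 1 : ℕ) : ℝ) * f x⌋₊ : ℝ) / ((n + 1 : ℕ) : ℝ)) atTop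
      (𝓝 (f x)) := by
    simpa [Function.comp_def, mul_comm] using h
  refine h'.congr' ?_
  filter_upwards [eventually_ge_atTop ⌈max ‖x‖ (f x)⌉₊] with n hn
  have hn' := Nat.ceil_le.1 hn
  exact (levelApprox_eq ((le_max_left _ _).trans hn') ((le_max_right _ _).trans hn')).symm

/-- The Laplace functional of a Poisson point process on the event that the number of points in a
set `D` where the test function vanishes belongs to `S`. -/
theorem IsPoissonPointProcess.laplace_functional [IsFiniteMeasureOnCompacts Λ]
    (hX : IsPoissonPointProcess X Λ μ)
    {D : Set Plane} (hD : MeasurableSet D) (S : Set ℕ∞) {f : Plane → ℝ} (hf : Measurable f)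
    (hf0 : ∀ x, 0 ≤ f x) (hfD : ∀ x ∈ D, f x = 0)
    (hint : Integrable (fun x => 1 - Real.exp (-f x)) Λ)
    (hsum : ∀ᵐ ω ∂μ, Summable fun i => f (X i ω)) :
    ∫ ω, S.indicator (fun _ => (1 : ℝ)) (pointCount (fun i => X i ω) D) *
        Real.exp (-∑' i, f (X i ω)) ∂μ =
      μ.real {ω | pointCount (fun i => X i ω) D ∈ S} *
        Real.exp (-∫ x, (1 - Real.exp (-f x)) ∂Λ) := by
  have := hX.isProbabilityMeasure
  have hmeas : ∀ n, Measurable (levelApprox f n) := fun n =>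
    measurable_stepFun _ (measurableSet_levelCell hf n)
  have hind : Measurable fun ω =>
      S.indicator (fun _ => (1 : ℝ)) (pointCount (fun i => X i ω) D) :=
    (Measurable.of_discrete (f := S.indicator fun _ => (1 : ℝ))).comp
      (measurable_pointCount hX.measurable_point hD)
  have hind0 : ∀ k : ℕ∞, 0 ≤ S.indicator (fun _ => (1 : ℝ)) k ∧
      S.indicator (fun _ => (1 : ℝ)) k ≤ 1 := by
    intro k
    by_cases hk : k ∈ S <;> simp [hk]
  have h1 : Tendsto (fun n => ∫ ω, S.indicator (fun _ => (1 : ℝ)) (pointCount (fun i => X i ω) D) *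
      Real.exp (-∑' i, levelApprox f n (X i ω)) ∂μ) atTop
      (𝓝 (∫ ω, S.indicator (fun _ => (1 : ℝ)) (pointCount (fun i => X i ω) D) *
        Real.exp (-∑' i, f (X i ω)) ∂μ)) := by
    refine tendsto_integral_of_dominated_convergence (fun _ => (1 : ℝ)) (fun n => ?_)
      (integrable_const _) (fun n => ?_) ?_
    · refine (hind.mul (Measurable.exp (Measurable.neg ?_))).aestronglyMeasurable
      exact Measurable.tsum fun i => (hmeas n).comp (hX.measurable_point i)
    · filter_upwards with ω
      have h := hind0 (pointCount (fun i => X i ω) D)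
      rw [Real.norm_of_nonneg (mul_nonneg h.1 (Real.exp_nonneg _))]
      refine mul_le_one₀ h.2 (Real.exp_nonneg _) (Real.exp_le_one_iff.2 ?_)
      exact neg_nonpos.2 (tsum_nonneg fun i => levelApprox_nonneg _ _ _)
    · filter_upwards [hsum] with ω hω
      refine Tendsto.const_mul _ ((Real.continuous_exp.tendsto _).comp (Tendsto.neg ?_))
      refine tendsto_tsum_of_dominated_convergence hω (fun i => tendsto_levelApprox (hf0 _)) ?_
      filter_upwards with n i
      rw [Real.norm_of_nonneg (levelApprox_nonneg _ _ _)]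
      exact levelApprox_le n (hf0 _)
  have h2 : Tendsto (fun n => ∫ x, (1 - Real.exp (-levelApprox f n x)) ∂Λ) atTop
      (𝓝 (∫ x, (1 - Real.exp (-f x)) ∂Λ)) := by
    refine tendsto_integral_of_dominated_convergence _ (fun n => ?_) hint (fun n => ?_) ?_
    · exact (measurable_const.sub (hmeas n).neg.exp).aestronglyMeasurable
    · filter_upwards with x
      have h3 : Real.exp (-levelApprox f n x) ≤ 1 :=
        Real.exp_le_one_iff.2 (neg_nonpos.2 (levelApprox_nonneg _ _ _))
      rw [Real.norm_of_nonneg (sub_nonneg.2 h3)]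
      exact sub_le_sub_left (Real.exp_le_exp.2 (neg_le_neg (levelApprox_le n (hf0 x)))) _
    · filter_upwards with x
      exact ((Real.continuous_exp.tendsto _).comp (tendsto_levelApprox (hf0 x)).neg).const_sub _
  refine tendsto_nhds_unique h1 (Tendsto.congr (fun n => ?_)
    (((Real.continuous_exp.tendsto _).comp h2.neg).const_mul _))
  refine (hX.laplace_stepFun hD S _ (measurableSet_levelCell hf n) (fun j => ?_)
    (pairwise_disjoint_levelCell f n) fun j => ?_).symm
  · exact ne_top_of_le_ne_top (isCompact_closedBall _ _).measure_ne_top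
      (measure_mono Set.inter_subset_left)
  -- Cells carry levels at least 1, whereas `f` vanishes on `D`.
  · refine Set.disjoint_left.2 fun x hxD hx => ?_
    have := hx.2
    simp [hfD x hxD] at this

end LaplaceFunctional

/-! ### Integrating out the exponential gains. -/

section ExponentialGains

open Filter Topology

theorem expMeasure_one_eq :
    expMeasure 1 = (volume.restrict (Set.Ioi (0 : ℝ))).withDensity
      fun x => ENNReal.ofReal (Real.exp (-x)) := by
  rw [expMeasure, gammaMeasure, Measure.restrict_congr_set Ioi_ae_eq_Ici,
    ← withDensity_indicator measurableSet_Ici]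
  congr 1
  ext x
  have := exponentialPDF_eq 1 x
  rw [exponentialPDF, exponentialPDFReal] at this
  rw [gammaPDF, this]
  by_cases hx : 0 ≤ x <;> simp [hx]

theorem integral_expMeasure_one (f : ℝ → ℝ) :
    ∫ x, f x ∂expMeasure 1 = ∫ x in Set.Ioi 0, Real.exp (-x) * f x := by
  rw [expMeasure_one_eq, integral_withDensity_eq_integral_toReal_smul (by fun_prop) (by simp)]
  refine integral_congr_ae (.of_forall fun x => ?_)
  simp [ENNReal.toReal_ofReal (Real.exp_nonneg _)]

theorem integral_exp_neg_mul_expMeasure_one {c : ℝ} (hc : 0 ≤ c) :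
    ∫ x, Real.exp (-(c * x)) ∂expMeasure 1 = (1 + c)⁻¹ := by
  rw [integral_expMeasure_one]
  have h := integral_exp_mul_Ioi (a := -(1 + c)) (by linarith) 0
  rw [mul_zero, Real.exp_zero, div_neg, neg_div, neg_neg, one_div] at h
  rw [← h]
  refine integral_congr_ae (.of_forall fun x => ?_)
  simp only [← Real.exp_add]
  congr 1; ring

theorem ae_nonneg_expMeasure_one : ∀ᵐ x ∂expMeasure 1, 0 ≤ x := by
  rw [expMeasure_one_eq]
  refine (withDensity_absolutelyContinuous _ _).ae_le ?_
  filter_upwards [ae_restrict_mem measurableSet_Ioi] with x hx using le_of_lt hx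

theorem lintegral_enorm_expMeasure_one : ∫⁻ x, ‖x‖ₑ ∂expMeasure 1 ≠ ⊤ := by
  rw [expMeasure_one_eq, lintegral_withDensity_eq_lintegral_mul _ (by fun_prop) (by fun_prop)]
  have h := (Real.GammaIntegral_convergent (s := 2) (by norm_num)).2
  rw [hasFiniteIntegral_iff_enorm] at h
  refine ((lintegral_congr_ae ?_).trans_lt h).ne
  filter_upwards with x
  rw [show (2 : ℝ) - 1 = 1 by norm_num, Real.rpow_one, enorm_mul, Pi.mul_apply,
    Real.enorm_of_nonneg (Real.exp_nonneg _)]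

variable {Ω : Type*} [MeasurableSpace Ω] {μ : Measure Ω}

theorem ae_summable_of_tsum_lintegral_ne_top {f : ℕ → Ω → ℝ} (hf : ∀ i, AEMeasurable (f i) μ)
    (h : ∑' i, ∫⁻ ω, ‖f i ω‖ₑ ∂μ ≠ ⊤) : ∀ᵐ ω ∂μ, Summable fun i => f i ω := by
  rw [← lintegral_tsum fun i => (hf i).enorm] at h
  filter_upwards [ae_lt_top' (AEMeasurable.tsum fun i => (hf i).enorm) h] with ω hω
  refine Summable.of_norm ((ENNReal.summable_toReal hω.ne).congr fun i => ?_)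
  simp

variable {h : ℕ → Ω → ℝ}

/-- Independence gives the product of the factors 1/(1 + c i). The logarithmic form turns it into an
exponential of a sum over points, as the Laplace functional requires. -/
theorem integral_exp_neg_sum_gains (hlaw : ∀ i, HasLaw (h i) (expMeasure 1) μ)
    (hind : iIndepFun h μ) {c : ℕ → ℝ} (hc : ∀ i, 0 ≤ c i) (n : ℕ) :
    ∫ ω, Real.exp (-∑ i ∈ Finset.range n, c i * h i ω) ∂μ =
      Real.exp (-∑ i ∈ Finset.range n, Real.log (1 + c i)) := by
  have hn : iIndepFun (fun (j : Fin n) => h j) μ := hind.precomp Fin.val_injective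
  have key := hn.integral_fun_prod_comp
    (f := fun (j : Fin n) x => Real.exp (-(c j * x))) (fun j => (hlaw j).aemeasurable)
    (fun j => Measurable.aestronglyMeasurable (by fun_prop))
  have h1 : ∀ j, ∫ ω, Real.exp (-(c j * h j ω)) ∂μ = Real.exp (-Real.log (1 + c j)) := by
    intro j
    have := (hlaw j).integral_comp (f := fun x => Real.exp (-(c j * x)))
      (Measurable.aestronglyMeasurable (by fun_prop))
    simp only [Function.comp_def] at this
    rw [this, integral_exp_neg_mul_expMeasure_one (hc j), Real.exp_neg,
      Real.exp_log (by linarith [hc j])]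
  simp only [h1, ← Real.exp_sum, Finset.sum_neg_distrib] at key
  simpa only [Finset.sum_range] using key

theorem ae_summable_mul_gains (hlaw : ∀ i, HasLaw (h i) (expMeasure 1) μ)
    {c : ℕ → ℝ} (hc : ∀ i, 0 ≤ c i) (hs : Summable c) :
    ∀ᵐ ω ∂μ, Summable fun i => c i * h i ω := by
  refine ae_summable_of_tsum_lintegral_ne_top (fun i => (hlaw i).aemeasurable.const_mul _) ?_
  have h1 : ∀ i, ∫⁻ ω, ‖c i * h i ω‖ₑ ∂μ =
      ENNReal.ofReal (c i) * ∫⁻ x, ‖x‖ₑ ∂expMeasure 1 := by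
    intro i
    rw [← (hlaw i).map_eq, lintegral_map' (by fun_prop) (hlaw i).aemeasurable,
      ← lintegral_const_mul' _ _ ENNReal.ofReal_ne_top]
    refine lintegral_congr fun ω => ?_
    rw [enorm_mul, Real.enorm_of_nonneg (hc i)]
  simp only [h1]
  rw [ENNReal.tsum_mul_right]
  exact ENNReal.mul_ne_top hs.tsum_ofReal_ne_top lintegral_enorm_expMeasure_one

theorem summable_log_one_add {c : ℕ → ℝ} (hc : ∀ i, 0 ≤ c i) (hs : Summable c) :
    Summable fun i => Real.log (1 + c i) :=
  hs.of_nonneg_of_le (fun i => Real.log_nonneg (by linarith [hc i]))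
    (fun i => by linarith [Real.log_le_sub_one_of_pos (x := 1 + c i) (by linarith [hc i])])

theorem ae_nonneg_gains (hlaw : ∀ i, HasLaw (h i) (expMeasure 1) μ) :
    ∀ᵐ ω ∂μ, ∀ i, 0 ≤ h i ω := by
  refine ae_all_iff.2 fun i => ?_
  have := ae_nonneg_expMeasure_one
  rw [← (hlaw i).map_eq] at this
  exact ae_of_ae_map (hlaw i).aemeasurable this

theorem integral_exp_neg_tsum_gains (hlaw : ∀ i, HasLaw (h i) (expMeasure 1) μ)
    (hind : iIndepFun h μ) {c : ℕ → ℝ} (hc : ∀ i, 0 ≤ c i) (hs : Summable c) :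
    ∫ ω, Real.exp (-∑' i, c i * h i ω) ∂μ = Real.exp (-∑' i, Real.log (1 + c i)) := by
  have := hind.isProbabilityMeasure
  have h1 : Tendsto (fun n => ∫ ω, Real.exp (-∑ i ∈ Finset.range n, c i * h i ω) ∂μ) atTop
      (𝓝 (∫ ω, Real.exp (-∑' i, c i * h i ω) ∂μ)) := by
    refine tendsto_integral_of_dominated_convergence (fun _ => (1 : ℝ)) (fun n => ?_)
      (integrable_const _) (fun n => ?_) ?_
    · refine AEMeasurable.aestronglyMeasurable (AEMeasurable.exp (AEMeasurable.neg ?_))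
      exact Finset.aemeasurable_fun_sum _ fun i _ => (hlaw i).aemeasurable.const_mul _
    · filter_upwards [ae_nonneg_gains hlaw] with ω hω
      rw [Real.norm_of_nonneg (Real.exp_nonneg _), Real.exp_le_one_iff, neg_nonpos]
      exact Finset.sum_nonneg fun i _ => mul_nonneg (hc i) (hω i)
    · filter_upwards [ae_summable_mul_gains hlaw hc hs] with ω hω
      exact (Real.continuous_exp.tendsto _).comp hω.hasSum.tendsto_sum_nat.neg
  refine tendsto_nhds_unique h1 (Tendsto.congr (fun n =>
    (integral_exp_neg_sum_gains hlaw hind hc n).symm) ?_)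
  exact (Real.continuous_exp.tendsto _).comp
    (summable_log_one_add hc hs).hasSum.tendsto_sum_nat.neg

/-- Integrating out the gains when their weights are random but independent of them. -/
theorem setIntegral_exp_neg_tsum_gains {𝓧 : Type*} [MeasurableSpace 𝓧] {ξ : Ω → 𝓧}
    (hξ : Measurable ξ) (hlaw : ∀ i, HasLaw (h i) (expMeasure 1) μ)
    (hind : iIndepFun h μ) (hξh : IndepFun ξ (fun ω i => h i ω) μ)
    {c : 𝓧 → ℕ → ℝ} (hcm : ∀ i, Measurable fun x => c x i) (hc : ∀ x i, 0 ≤ c x i)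
    (hs : ∀ᵐ ω ∂μ, Summable (c (ξ ω))) {E : Set 𝓧} (hE : MeasurableSet E) :
    ∫ ω in ξ ⁻¹' E, Real.exp (-∑' i, c (ξ ω) i * h i ω) ∂μ =
      ∫ ω in ξ ⁻¹' E, Real.exp (-∑' i, Real.log (1 + c (ξ ω) i)) ∂μ := by
  have := hind.isProbabilityMeasure
  have hh : AEMeasurable (fun ω i => h i ω) μ := aemeasurable_pi_iff.2 fun i =>
    (hlaw i).aemeasurable
  set F : 𝓧 × (ℕ → ℝ) → ℝ := fun p =>
    E.indicator (fun _ => (1 : ℝ)) p.1 * Real.exp (-∑' i, c p.1 i * p.2 i) with hF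
  have hFm : Measurable F := by
    refine ((measurable_const.indicator hE).comp measurable_fst).mul
      (Measurable.exp (Measurable.neg (Measurable.tsum fun i => ?_)))
    exact ((hcm i).comp measurable_fst).mul ((measurable_pi_apply i).comp measurable_snd)
  have hpair : AEMeasurable (fun ω => (ξ ω, fun i => h i ω)) μ := hξ.aemeasurable.prodMk hh
  have hFint : Integrable F (μ.map fun ω => (ξ ω, fun i => h i ω)) := by
    rw [integrable_map_measure hFm.aestronglyMeasurable hpair]
    refine Integrable.of_bound (hFm.comp_aemeasurable hpair).aestronglyMeasurable 1 ?_
    filter_upwards [ae_nonneg_gains hlaw] with ω hω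
    rw [Function.comp, hF]
    have h1 : Real.exp (-∑' i, c (ξ ω) i * h i ω) ≤ 1 :=
      Real.exp_le_one_iff.2 (neg_nonpos.2 (tsum_nonneg fun i => mul_nonneg (hc _ _) (hω i)))
    by_cases hE' : ξ ω ∈ E <;> simp [hE'] at h1 ⊢
    exact h1
  have h1 : ∫ ω, F (ξ ω, fun i => h i ω) ∂μ =
      ∫ ω, E.indicator (fun _ => (1 : ℝ)) (ξ ω) *
        Real.exp (-∑' i, Real.log (1 + c (ξ ω) i)) ∂μ := by
    rw [← integral_map (f := F) hpair hFm.aestronglyMeasurable]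
    -- Independence makes the joint law a product, so Fubini freezes the weights and the formula for
    -- deterministic weights applies.
    have hprod := (indepFun_iff_map_prod_eq_prod_map_map hξ.aemeasurable hh).1 hξh
    rw [hprod] at hFint ⊢
    rw [integral_prod F hFint, integral_map hξ.aemeasurable
      (hFint.aestronglyMeasurable.integral_prod_right')]
    refine integral_congr_ae ?_
    filter_upwards [hs] with ω hω
    rw [integral_map (f := fun y => F (ξ ω, y)) hh
      (hFm.comp measurable_prodMk_left).aestronglyMeasurable]
    simp only [hF]
    rw [integral_const_mul, integral_exp_neg_tsum_gains hlaw hind (hc _) hω]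
  rw [← integral_indicator (hξ hE), ← integral_indicator (hξ hE)]
  convert h1 using 2
  · ext ω
    by_cases hE' : ξ ω ∈ E <;> simp [hF, hE']
  · ext ω
    by_cases hE' : ξ ω ∈ E <;> simp [hE']

end ExponentialGains

/-! ### Conditioning on a real variable through shrinking cells. -/

section Discretization

open Filter Topology

variable {Ω : Type*} [MeasurableSpace Ω] {μ : Measure Ω}

/-- Two functions have the same integrals over the events determined by `R` if their weighted
integrals agree for every bounded continuous weight in `R`. -/
theorem setIntegral_preimage_eq_of_forall_boundedContinuous [IsFiniteMeasure μ] {R : Ω → ℝ}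
    (hR : Measurable R) {f g : Ω → ℝ} (hf : Integrable f μ) (hg : Integrable g μ)
    (hf0 : 0 ≤ᵐ[μ] f) (hg0 : 0 ≤ᵐ[μ] g)
    (h : ∀ φ : BoundedContinuousFunction ℝ ℝ, ∫ ω, f ω * φ (R ω) ∂μ = ∫ ω, g ω * φ (R ω) ∂μ)
    {B : Set ℝ} (hB : MeasurableSet B) :
    ∫ ω in R ⁻¹' B, f ω ∂μ = ∫ ω in R ⁻¹' B, g ω ∂μ := by
  have hint : ∀ {u : Ω → ℝ}, Integrable u μ → 0 ≤ᵐ[μ] u → ∀ φ : BoundedContinuousFunction ℝ ℝ,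
      ∫ x, φ x ∂((μ.withDensity fun ω => ENNReal.ofReal (u ω)).map R) =
        ∫ ω, u ω * φ (R ω) ∂μ := by
    intro u hu hu0 φ
    rw [integral_map hR.aemeasurable φ.continuous.aestronglyMeasurable,
      integral_withDensity_eq_integral_toReal_smul₀ hu.1.aemeasurable.ennreal_ofReal (by simp)]
    refine integral_congr_ae ?_
    filter_upwards [hu0] with ω hω
    rw [ENNReal.toReal_ofReal hω, smul_eq_mul]
  have hset : ∀ {u : Ω → ℝ}, Integrable u μ → 0 ≤ᵐ[μ] u →
      ∫ ω in R ⁻¹' B, u ω ∂μ =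
        (((μ.withDensity fun ω => ENNReal.ofReal (u ω)).map R) B).toReal := by
    intro u hu hu0
    rw [Measure.map_apply hR hB, withDensity_apply _ (hR hB),
      integral_eq_lintegral_of_nonneg_ae (ae_restrict_of_ae hu0) hu.1.restrict]
  have hfin : ∀ {u : Ω → ℝ}, Integrable u μ →
      IsFiniteMeasure ((μ.withDensity fun ω => ENNReal.ofReal (u ω)).map R) := by
    intro u hu
    have := isFiniteMeasure_withDensity_ofReal hu.2
    infer_instance
  have := hfin hf
  have := hfin hg
  -- Finite measures on the line are determined by bounded continuous functions.
  have heq : (μ.withDensity fun ω => ENNReal.ofReal (f ω)).map R =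
      (μ.withDensity fun ω => ENNReal.ofReal (g ω)).map R :=
    ext_of_forall_integral_eq_of_IsFiniteMeasure fun φ => by
      rw [hint hf hf0, hint hg hg0, h]
  rw [hset hf hf0, hset hg hg0, heq]

set_option maxHeartbeats 1000000 in
/-- If two families of functions have the same integrals over the cells `{r < R ≤ s}`, then their
limits on shrinking cells have the same integrals over all events determined by `R`. -/
theorem setIntegral_eq_of_cells [IsFiniteMeasure μ] {R : Ω → ℝ} (hR : Measurable R)
    (hpos : ∀ᵐ ω ∂μ, 0 < R ω) {F G : ℝ → ℝ → Ω → ℝ} {f g : Ω → ℝ}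
    (hFm : ∀ r s, Measurable (F r s)) (hGm : ∀ r s, Measurable (G r s))
    (hF : ∀ r s ω, F r s ω ∈ Set.Icc (0 : ℝ) 1) (hG : ∀ r s ω, G r s ω ∈ Set.Icc (0 : ℝ) 1)
    (hcell : ∀ r s, 0 ≤ r → r < s →
      ∫ ω in {ω | r < R ω ∧ R ω ≤ s}, F r s ω ∂μ = ∫ ω in {ω | r < R ω ∧ R ω ≤ s}, G r s ω ∂μ)
    (hFlim : ∀ᵐ ω ∂μ, ∀ u v : ℕ → ℝ, (∀ n, u n < R ω) → (∀ n, R ω ≤ v n) →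
      Tendsto u atTop (𝓝 (R ω)) → Tendsto v atTop (𝓝 (R ω)) →
      Tendsto (fun n => F (u n) (v n) ω) atTop (𝓝 (f ω)))
    (hGlim : ∀ᵐ ω ∂μ, ∀ u v : ℕ → ℝ, (∀ n, u n < R ω) → (∀ n, R ω ≤ v n) →
      Tendsto u atTop (𝓝 (R ω)) → Tendsto v atTop (𝓝 (R ω)) →
      Tendsto (fun n => G (u n) (v n) ω) atTop (𝓝 (g ω)))
    {B : Set ℝ} (hB : MeasurableSet B) :
    ∫ ω in R ⁻¹' B, f ω ∂μ = ∫ ω in R ⁻¹' B, g ω ∂μ := by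
  -- `κ n ω` indexes the cell of width 1/(n + 1) containing `R ω`; the ceiling makes cells open on
  -- the left and closed on the right.
  set κ : ℕ → Ω → ℕ := fun n ω => ⌈((n : ℝ) + 1) * R ω⌉₊ with hκ
  have hκm : ∀ n, Measurable (κ n) := fun n => Nat.measurable_ceil.comp (hR.const_mul _)
  set lo : ℕ → ℕ → ℝ := fun n k => ((k : ℝ) - 1) / (n + 1) with hlo
  set hi : ℕ → ℕ → ℝ := fun n k => (k : ℝ) / (n + 1) with hhi
  have hbd : ∀ᵐ ω ∂μ, ∀ n, lo n (κ n ω) < R ω ∧ R ω ≤ hi n (κ n ω) := by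
    filter_upwards [hpos] with ω hω n
    have hn : (0 : ℝ) < n + 1 := by positivity
    simp only [hlo, hhi, hκ]
    rw [div_lt_iff₀ hn, le_div_iff₀ hn, mul_comm (R ω)]
    have := Nat.ceil_lt_add_one (mul_pos hn hω).le
    exact ⟨by linarith, Nat.le_ceil _⟩
  have hlim : ∀ᵐ ω ∂μ, Tendsto (fun n => lo n (κ n ω)) atTop (𝓝 (R ω)) ∧
      Tendsto (fun n => hi n (κ n ω)) atTop (𝓝 (R ω)) := by
    filter_upwards [hbd] with ω hω
    have h0 := tendsto_one_div_add_atTop_nhds_zero_nat (𝕜 := ℝ)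
    have hd : ∀ n, hi n (κ n ω) = lo n (κ n ω) + 1 / ((n : ℝ) + 1) := by
      intro n; simp only [hlo, hhi]; ring
    constructor
    · refine tendsto_of_tendsto_of_tendsto_of_le_of_le (g := fun n : ℕ => R ω - 1 / ((n : ℝ) + 1))
        (h := fun _ => R ω) (by simpa using h0.const_sub (R ω)) tendsto_const_nhds
        (fun n => ?_) (fun n => (hω n).1.le)
      have := (hω n).2
      rw [hd n] at this
      simp only
      linarith
    · refine tendsto_of_tendsto_of_tendsto_of_le_of_le (g := fun _ => R ω)
        (h := fun n : ℕ => R ω + 1 / ((n : ℝ) + 1)) tendsto_const_nhds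
        (by simpa using h0.const_add (R ω)) (fun n => (hω n).2) (fun n => ?_)
      have := (hω n).1
      rw [hd n]
      simp only
      linarith
  -- The approximating sums involve `H` only through its integrals over cells, which agree for `F`
  -- and `G`. Evaluating `φ` at the right endpoint makes it constant on each cell.
  have main : ∀ {H : ℝ → ℝ → Ω → ℝ} {u : Ω → ℝ}, (∀ r s, Measurable (H r s)) →
      (∀ r s ω, H r s ω ∈ Set.Icc (0 : ℝ) 1) →
      (∀ᵐ ω ∂μ, ∀ u' v : ℕ → ℝ, (∀ n, u' n < R ω) → (∀ n, R ω ≤ v n) →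
        Tendsto u' atTop (𝓝 (R ω)) → Tendsto v atTop (𝓝 (R ω)) →
        Tendsto (fun n => H (u' n) (v n) ω) atTop (𝓝 (u ω))) →
      Integrable u μ ∧ 0 ≤ᵐ[μ] u ∧ ∀ φ : BoundedContinuousFunction ℝ ℝ,
        Tendsto (fun n => ∑' k, φ (hi n k) * ∫ ω in κ n ⁻¹' {k}, H (lo n k) (hi n k) ω ∂μ) atTop
          (𝓝 (∫ ω, u ω * φ (R ω) ∂μ)) := by
    intro H u hHm hH hHlim
    have hHn : ∀ n, Measurable fun ω => H (lo n (κ n ω)) (hi n (κ n ω)) ω := fun n =>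
      (measurable_from_prod_countable_right (f := fun p : ℕ × Ω => H (lo n p.1) (hi n p.1) p.2)
        fun k => hHm (lo n k) (hi n k)).comp ((hκm n).prodMk measurable_id)
    have hconv : ∀ᵐ ω ∂μ,
        Tendsto (fun n => H (lo n (κ n ω)) (hi n (κ n ω)) ω) atTop (𝓝 (u ω)) := by
      filter_upwards [hHlim, hbd, hlim] with ω h1 h2 h3
      exact h1 _ _ (fun n => (h2 n).1) (fun n => (h2 n).2) h3.1 h3.2
    have hum : AEMeasurable u μ :=
      aemeasurable_of_tendsto_metrizable_ae atTop (fun n => (hHn n).aemeasurable) hconv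
    have hu01 : ∀ᵐ ω ∂μ, u ω ∈ Set.Icc (0 : ℝ) 1 := by
      filter_upwards [hconv] with ω hω
      exact isClosed_Icc.mem_of_tendsto hω (.of_forall fun n => hH _ _ _)
    refine ⟨Integrable.of_bound hum.aestronglyMeasurable 1 ?_, ?_, fun φ => ?_⟩
    · filter_upwards [hu01] with ω hω
      rw [Real.norm_of_nonneg hω.1]; exact hω.2
    · filter_upwards [hu01] with ω hω using hω.1
    have hφm : ∀ n, Measurable fun ω =>
        H (lo n (κ n ω)) (hi n (κ n ω)) ω * φ (hi n (κ n ω)) := fun n =>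
      (hHn n).mul ((Measurable.of_discrete (f := fun k => φ (hi n k))).comp (hκm n))
    have hφb : ∀ n ω, ‖H (lo n (κ n ω)) (hi n (κ n ω)) ω * φ (hi n (κ n ω))‖ ≤ ‖φ‖ := by
      intro n ω
      have h1 := hH (lo n (κ n ω)) (hi n (κ n ω)) ω
      rw [norm_mul, Real.norm_of_nonneg h1.1]
      exact (mul_le_mul h1.2 (φ.norm_coe_le_norm _) (norm_nonneg _) zero_le_one).trans_eq
        (one_mul _)
    have hT : Tendsto (fun n => ∫ ω, H (lo n (κ n ω)) (hi n (κ n ω)) ω * φ (hi n (κ n ω)) ∂μ) atTop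
        (𝓝 (∫ ω, u ω * φ (R ω) ∂μ)) := by
      refine tendsto_integral_of_dominated_convergence (fun _ => ‖φ‖)
        (fun n => (hφm n).aestronglyMeasurable) (integrable_const _)
        (fun n => .of_forall (hφb n)) ?_
      filter_upwards [hconv, hlim] with ω h1 h2
      exact h1.mul ((φ.continuous.tendsto _).comp h2.2)
    refine hT.congr fun n => ?_
    have hU : (⋃ k, κ n ⁻¹' {k}) = Set.univ := by
      ext ω; simp
    rw [← setIntegral_univ, ← hU, integral_iUnion (fun k => hκm n (measurableSet_singleton k))]
    · refine tsum_congr fun k => ?_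
      rw [← integral_const_mul]
      refine setIntegral_congr_fun (hκm n (measurableSet_singleton k)) fun ω hω => ?_
      have : κ n ω = k := hω
      simp only [this, mul_comm]
    · intro i j hij
      exact Disjoint.preimage _ (Set.disjoint_singleton.2 hij)
    · exact (Integrable.of_bound (hφm n).aestronglyMeasurable ‖φ‖ (.of_forall (hφb n))).integrableOn
  obtain ⟨hfi, hf0, hfT⟩ := main hFm hF hFlim
  obtain ⟨hgi, hg0, hgT⟩ := main hGm hG hGlim
  refine setIntegral_preimage_eq_of_forall_boundedContinuous hR hfi hgi hf0 hg0 (fun φ => ?_) hB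
  refine tendsto_nhds_unique (hfT φ) ((hgT φ).congr fun n => tsum_congr fun k => ?_)
  congr 1
  rcases k with _ | k
  -- Cell 0 has a negative left endpoint, outside the range of `hcell`, but it is null because R > 0
  -- almost surely.
  · have h0 : μ (κ n ⁻¹' {0}) = 0 := by
      refine measure_mono_null (fun ω hω => ?_) (ae_iff.1 hpos)
      intro hpos'
      have h1 : ⌈((n : ℝ) + 1) * R ω⌉₊ = 0 := hω
      rw [Nat.ceil_eq_zero] at h1
      have : 0 < ((n : ℝ) + 1) * R ω := mul_pos (by positivity) hpos'
      linarith
    rw [setIntegral_measure_zero _ h0, setIntegral_measure_zero _ h0]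
  · have hset : κ n ⁻¹' {k + 1} = {ω | lo n (k + 1) < R ω ∧ R ω ≤ hi n (k + 1)} := by
      ext ω
      have hn : (0 : ℝ) < n + 1 := by positivity
      change ⌈((n : ℝ) + 1) * R ω⌉₊ = k + 1 ↔ ((k + 1 : ℕ) - 1 : ℝ) / (n + 1) < R ω ∧
        R ω ≤ ((k + 1 : ℕ) : ℝ) / (n + 1)
      rw [Nat.ceil_eq_iff (by omega), div_lt_iff₀ hn, le_div_iff₀ hn, mul_comm (R ω)]
      simp
    rw [hset]
    refine (hcell (lo n (k + 1)) (hi n (k + 1)) ?_ ?_).symm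
    · simp only [hlo, Nat.cast_add_one, add_sub_cancel_right]
      positivity
    · simp only [hlo, hhi]
      exact div_lt_div_of_pos_right (by linarith) (by positivity)

end Discretization

/-! ### The two radial integrals. -/

section PlaneIntegrals

open Filter Topology

theorem integral_fun_norm_plane (f : ℝ → ℝ) :
    ∫ x : Plane, f ‖x‖ = 2 * Real.pi * ∫ y in Set.Ioi (0 : ℝ), y * f y := by
  rw [integral_fun_norm_addHaar]
  simp [Measure.real, Real.pi_nonneg, mul_assoc]

theorem hasDerivAt_arctan_sq_div {b : ℝ} (hb : 0 < b) (y : ℝ) :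
    HasDerivAt (fun y => b / 2 * Real.arctan (y ^ 2 / b)) (y * (b ^ 2 / (y ^ 4 + b ^ 2))) y := by
  refine ((((hasDerivAt_pow 2 y).div_const b).arctan).const_mul (b / 2)).congr_deriv ?_
  have : 0 < y ^ 4 + b ^ 2 := by positivity
  have : 0 < b ^ 2 + y ^ 4 := by positivity
  have h1 : 1 + (y ^ 2 / b) ^ 2 = (y ^ 4 + b ^ 2) / b ^ 2 := by field_simp; ring
  rw [h1]
  field_simp
  norm_num

theorem integral_Ioi_mul_div_pow_four_add {b : ℝ} (hb : 0 < b) {r : ℝ} (hr : 0 ≤ r) :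
    ∫ y in Set.Ioi r, y * (b ^ 2 / (y ^ 4 + b ^ 2)) =
      b / 2 * (Real.pi / 2 - Real.arctan (r ^ 2 / b)) := by
  have h := integral_Ioi_of_hasDerivAt_of_nonneg' (a := r) (l := b / 2 * (Real.pi / 2))
    (g := fun y => b / 2 * Real.arctan (y ^ 2 / b))
    (g' := fun y => y * (b ^ 2 / (y ^ 4 + b ^ 2)))
    (fun y _ => hasDerivAt_arctan_sq_div hb y) (fun y hy => ?_) ?_
  · rw [h]; ring
  · have : 0 < y := hr.trans_lt hy
    positivity
  · refine Tendsto.const_mul _ ?_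
    refine (Real.tendsto_arctan_atTop.mono_right nhdsWithin_le_nhds).comp ?_
    exact (tendsto_pow_atTop two_ne_zero).atTop_div_const hb

/-- The integrand is y minus the derivative of the arctangent primitive above. -/
theorem integral_Ioc_mul_pow_four_div {b : ℝ} (hb : 0 < b) {r : ℝ} (hr : 0 ≤ r) :
    ∫ y in Set.Ioc 0 r, y * (y ^ 4 / (y ^ 4 + b ^ 2)) =
      r ^ 2 / 2 - b / 2 * Real.arctan (r ^ 2 / b) := by
  have hcont : Continuous fun y : ℝ => y * (y ^ 4 / (y ^ 4 + b ^ 2)) := by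
    refine continuous_id.mul ((continuous_pow 4).div₀ (by fun_prop) fun y => ?_)
    positivity
  rw [← intervalIntegral.integral_of_le hr,
    intervalIntegral.integral_eq_sub_of_hasDerivAt
      (f := fun y => y ^ 2 / 2 - b / 2 * Real.arctan (y ^ 2 / b)) (fun y _ => ?_)
      (hcont.intervalIntegrable _ _)]
  · simp
  · have : 0 < y ^ 4 + b ^ 2 := by positivity
    refine (((hasDerivAt_pow 2 y).div_const 2).fun_sub
      (hasDerivAt_arctan_sq_div hb y)).congr_deriv ?_
    norm_num
    field_simp
    ring

/-- The ratio of the interference from a BS at `x` to the threshold, for a serving distance `r`: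
`T r ^ 4 / ‖x‖ ^ 4` outside the disc of radius `r`, zero inside. -/
noncomputable def outerWeight (T r : ℝ) (x : Plane) : ℝ :=
  {x : Plane | r < ‖x‖}.indicator (fun x => T * r ^ 4 / ‖x‖ ^ 4) x

theorem outerWeight_nonneg {T : ℝ} (hT : 0 ≤ T) (r : ℝ) (x : Plane) : 0 ≤ outerWeight T r x :=
  Set.indicator_nonneg (fun _ _ => by positivity) _

theorem measurable_outerWeight (T : ℝ) :
    Measurable fun p : ℝ × Plane => outerWeight T p.1 p.2 := by
  have : (fun p : ℝ × Plane => outerWeight T p.1 p.2) =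
      {p : ℝ × Plane | p.1 < ‖p.2‖}.indicator fun p => T * p.1 ^ 4 / ‖p.2‖ ^ 4 := by
    ext p; rfl
  rw [this]
  exact Measurable.indicator (by fun_prop) (measurableSet_lt measurable_fst measurable_snd.norm)

theorem one_sub_exp_neg_log_outerWeight {T : ℝ} (hT : 0 < T) {r : ℝ} (hr : 0 < r) (x : Plane) :
    1 - Real.exp (-Real.log (1 + outerWeight T r x)) =
      (Set.Ioi r).indicator
        (fun y : ℝ => (√T * r ^ 2) ^ 2 / (y ^ 4 + (√T * r ^ 2) ^ 2)) ‖x‖ := by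
  rw [Real.exp_neg, Real.exp_log (by linarith [outerWeight_nonneg hT.le r x])]
  by_cases hx : r < ‖x‖
  · have h1 : outerWeight T r x = T * r ^ 4 / ‖x‖ ^ 4 :=
      Set.indicator_of_mem (s := {x : Plane | r < ‖x‖}) hx _
    rw [Set.indicator_of_mem (s := Set.Ioi r) hx, h1, mul_pow, Real.sq_sqrt hT.le]
    have : 0 < ‖x‖ := hr.trans hx
    have h2 : 0 < ‖x‖ ^ 4 + T * (r ^ 2) ^ 2 := by positivity
    have h3 : 1 + T * r ^ 4 / ‖x‖ ^ 4 = (‖x‖ ^ 4 + T * (r ^ 2) ^ 2) / ‖x‖ ^ 4 := by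
      field_simp
    rw [h3]
    field_simp
    ring
  · have h1 : outerWeight T r x = 0 :=
      Set.indicator_of_notMem (s := {x : Plane | r < ‖x‖}) hx _
    rw [Set.indicator_of_notMem (s := Set.Ioi r) hx, h1]
    simp

theorem integral_one_sub_exp_neg_log_outerWeight {T : ℝ} (hT : 0 < T) {r : ℝ} (hr : 0 < r) :
    ∫ x, (1 - Real.exp (-Real.log (1 + outerWeight T r x))) =
      Real.pi * r ^ 2 * (√T * Real.arctan √T) := by
  simp_rw [one_sub_exp_neg_log_outerWeight hT hr]
  have hb : 0 < √T * r ^ 2 := by positivity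
  rw [integral_fun_norm_plane]
  have h1 : ∀ y : ℝ, y * (Set.Ioi r).indicator
      (fun y : ℝ => (√T * r ^ 2) ^ 2 / (y ^ 4 + (√T * r ^ 2) ^ 2)) y =
      (Set.Ioi r).indicator
        (fun y : ℝ => y * ((√T * r ^ 2) ^ 2 / (y ^ 4 + (√T * r ^ 2) ^ 2))) y := by
    intro y
    by_cases hy : y ∈ Set.Ioi r <;> simp [hy]
  simp_rw [h1]
  rw [setIntegral_indicator measurableSet_Ioi, Set.inter_eq_right.2 (Set.Ioi_subset_Ioi hr.le),
    integral_Ioi_mul_div_pow_four_add hb hr.le]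
  have h2 : r ^ 2 / (√T * r ^ 2) = (√T)⁻¹ := by field_simp
  rw [h2, Real.arctan_inv_of_pos (Real.sqrt_pos.2 hT)]
  ring

theorem setIntegral_closedBall_inv_one_add {T : ℝ} (hT : 0 < T) {r : ℝ} (hr : 0 ≤ r) :
    ∫ x in Metric.closedBall (0 : Plane) r, (1 + T * r ^ 4 / ‖x‖ ^ 4)⁻¹ =
      Real.pi * r ^ 2 * (1 - √T * Real.arctan (1 / √T)) := by
  -- Radius 0 does occur, as the left endpoint of the first cell; the substitution b = √T r² needs r
  -- > 0.
  rcases hr.eq_or_lt with rfl | hr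
  · simp
  have hb : 0 < √T * r ^ 2 := by positivity
  rw [← integral_indicator measurableSet_closedBall]
  have h0 : ∀ x : Plane, (Metric.closedBall (0 : Plane) r).indicator
      (fun x => (1 + T * r ^ 4 / ‖x‖ ^ 4)⁻¹) x =
      (Set.Iic r).indicator (fun y : ℝ => (1 + T * r ^ 4 / y ^ 4)⁻¹) ‖x‖ := by
    intro x
    by_cases hx : ‖x‖ ≤ r <;> simp [hx]
  simp_rw [h0]
  rw [integral_fun_norm_plane]
  have h1 : ∀ y ∈ Set.Ioi (0 : ℝ), y * (Set.Iic r).indicator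
      (fun y : ℝ => (1 + T * r ^ 4 / y ^ 4)⁻¹) y =
      (Set.Iic r).indicator (fun y : ℝ => y * (y ^ 4 / (y ^ 4 + (√T * r ^ 2) ^ 2))) y := by
    intro y hy
    by_cases hy' : y ≤ r
    · rw [Set.indicator_of_mem (s := Set.Iic r) hy', Set.indicator_of_mem (s := Set.Iic r) hy',
        mul_pow, Real.sq_sqrt hT.le]
      have hy : 0 < y := hy
      congr 1
      have h2 : 0 < y ^ 4 + T * (r ^ 2) ^ 2 := by positivity
      have h3 : 1 + T * r ^ 4 / y ^ 4 = (y ^ 4 + T * (r ^ 2) ^ 2) / y ^ 4 := by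
        field_simp
      rw [h3, inv_div]
    · rw [Set.indicator_of_notMem (s := Set.Iic r) hy', Set.indicator_of_notMem (s := Set.Iic r) hy',
        mul_zero]
  rw [setIntegral_congr_fun measurableSet_Ioi h1, setIntegral_indicator measurableSet_Iic,
    Set.Ioi_inter_Iic, integral_Ioc_mul_pow_four_div hb hr.le]
  have h2 : r ^ 2 / (√T * r ^ 2) = 1 / √T := by field_simp
  rw [h2]
  ring

/-- From arctan u ≤ u. It keeps the limiting constant nonnegative, as the cell argument demands. -/
theorem mul_arctan_one_div_le_one {T : ℝ} (hT : 0 < T) : √T * Real.arctan (1 / √T) ≤ 1 := by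
  have hs := Real.sqrt_pos.2 hT
  have h : Real.arctan (1 / √T) ≤ 1 / √T := by
    have h0 : 0 < Real.arctan (1 / √T) := Real.arctan_pos.2 (by positivity)
    have := Real.lt_tan h0 (Real.arctan_lt_pi_div_two _)
    rw [Real.tan_arctan] at this
    exact this.le
  calc √T * Real.arctan (1 / √T) ≤ √T * (1 / √T) := by gcongr
    _ = 1 := by field_simp

end PlaneIntegrals

/-! ### Almost sure convergence of the interference. -/

section Summability

variable {Ω : Type*} [MeasurableSpace Ω] {X : ℕ → Ω → Plane} {h : ℕ → Ω → ℝ} {lam : ℝ}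
  {μ : Measure Ω}

instance isFiniteMeasureOnCompacts_smul_volume (lam : ℝ) :
    IsFiniteMeasureOnCompacts (ENNReal.ofReal lam • (volume : Measure Plane)) :=
  IsFiniteMeasureOnCompacts.smul _ ENNReal.ofReal_ne_top

theorem lintegral_enorm_one_add_norm_rpow_ne_top (lam : ℝ) :
    ∫⁻ x : Plane, ‖(1 + ‖x‖) ^ (-4 : ℝ)‖ₑ ∂(ENNReal.ofReal lam • volume) ≠ ⊤ := by
  have hint : Integrable fun x : Plane => (1 + ‖x‖) ^ (-4 : ℝ) :=
    integrable_one_add_norm (by simp; norm_num)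
  rw [lintegral_smul_measure, smul_eq_mul]
  exact ENNReal.mul_ne_top ENNReal.ofReal_ne_top hint.2.ne

/-- Campbell's formula gives a finite mean, because the exponent 4 exceeds the dimension 2. The
majorant does not depend on a cutoff radius, so one null set serves every radius. -/
theorem IsRayleighPoissonNetwork.ae_summable_one_add_norm_rpow
    (hnet : IsRayleighPoissonNetwork X h lam μ) :
    ∀ᵐ ω ∂μ, Summable fun i => (1 + ‖X i ω‖) ^ (-4 : ℝ) := by
  have hX := hnet.poisson.measurable_point
  refine ae_summable_of_tsum_lintegral_ne_top (fun i => ?_) ?_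
  · exact ((measurable_const.add (hX i).norm).pow_const _).aemeasurable
  · rw [hnet.poisson.tsum_lintegral (f := fun x => ‖(1 + ‖x‖) ^ (-4 : ℝ)‖ₑ) (by fun_prop)]
    exact lintegral_enorm_one_add_norm_rpow_ne_top lam

theorem IsRayleighPoissonNetwork.ae_summable_one_add_norm_rpow_mul
    (hnet : IsRayleighPoissonNetwork X h lam μ) :
    ∀ᵐ ω ∂μ, Summable fun i => (1 + ‖X i ω‖) ^ (-4 : ℝ) * h i ω := by
  have hX := hnet.poisson.measurable_point
  have hm : ∀ i, Measurable fun ω => (1 + ‖X i ω‖) ^ (-4 : ℝ) := fun i =>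
    (measurable_const.add (hX i).norm).pow_const _
  refine ae_summable_of_tsum_lintegral_ne_top
    (fun i => (hm i).aemeasurable.mul (hnet.gain_law i).aemeasurable) ?_
  have h1 : ∀ i, ∫⁻ ω, ‖(1 + ‖X i ω‖) ^ (-4 : ℝ) * h i ω‖ₑ ∂μ =
      (∫⁻ ω, ‖(1 + ‖X i ω‖) ^ (-4 : ℝ)‖ₑ ∂μ) * ∫⁻ x, ‖x‖ₑ ∂expMeasure 1 := by
    intro i
    rw [← (hnet.gain_law i).map_eq, lintegral_map' (by fun_prop) (hnet.gain_law i).aemeasurable]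
    simp_rw [enorm_mul]
    have hφ : Measurable fun x : ℕ → Plane => ‖(1 + ‖x i‖) ^ (-4 : ℝ)‖ₑ :=
      ((measurable_const.add (measurable_pi_apply i).norm).pow_const _).enorm
    have hψ : Measurable fun y : ℕ → ℝ => ‖y i‖ₑ := (measurable_pi_apply i).enorm
    have hind : IndepFun (fun ω => ‖(1 + ‖X i ω‖) ^ (-4 : ℝ)‖ₑ) (fun ω => ‖h i ω‖ₑ) μ :=
      hnet.gain_indep_points.comp hφ hψ
    exact lintegral_mul_eq_lintegral_mul_lintegral_of_indepFun'' (hm i).enorm.aemeasurable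
      (hnet.gain_law i).aemeasurable.enorm hind
  simp only [h1]
  rw [ENNReal.tsum_mul_right,
    hnet.poisson.tsum_lintegral (f := fun x => ‖(1 + ‖x‖) ^ (-4 : ℝ)‖ₑ) (by fun_prop)]
  exact ENNReal.mul_ne_top (lintegral_enorm_one_add_norm_rpow_ne_top lam)
    lintegral_enorm_expMeasure_one

/-- The ratio (1 + t)/t decreases in t, so beyond r it is at most (1 + r)/r. -/
theorem inv_norm_pow_four_le {r : ℝ} (hr : 0 < r) {x : Plane} (hx : r < ‖x‖) :
    (‖x‖ ^ 4)⁻¹ ≤ ((1 + r) / r) ^ 4 * (1 + ‖x‖) ^ (-4 : ℝ) := by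
  have hx0 : 0 < ‖x‖ := hr.trans hx
  rw [Real.rpow_neg (by positivity), show (4 : ℝ) = (4 : ℕ) by norm_num, Real.rpow_natCast,
    ← div_eq_mul_inv, ← div_pow, ← inv_pow]
  refine pow_le_pow_left₀ (by positivity) ?_ 4
  rw [inv_eq_one_div, div_div, div_le_div_iff₀ hx0 (by positivity)]
  nlinarith

theorem summable_outerWeight {T r : ℝ} (hT : 0 ≤ T) (hr : 0 < r) {x : ℕ → Plane}
    (hx : Summable fun i => (1 + ‖x i‖) ^ (-4 : ℝ)) : Summable fun i => outerWeight T r (x i) := by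
  refine (hx.mul_left (T * r ^ 4 * ((1 + r) / r) ^ 4)).of_nonneg_of_le
    (fun i => outerWeight_nonneg hT _ _) fun i => ?_
  refine Set.indicator_le' (f := fun x : Plane => T * r ^ 4 / ‖x‖ ^ 4) (g := fun x : Plane =>
    T * r ^ 4 * ((1 + r) / r) ^ 4 * (1 + ‖x‖) ^ (-4 : ℝ)) (fun y hy => ?_) (fun y _ => ?_) (x i)
  · rw [div_eq_mul_inv, mul_assoc (T * r ^ 4)]
    exact mul_le_mul_of_nonneg_left (inv_norm_pow_four_le hr hy) (by positivity)
  · positivity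

/-- The origin has zero intensity. It must be excluded because the real power gives `0 ^ (-4) = 0`:
a point there would count as the weakest station. -/
theorem IsRayleighPoissonNetwork.ae_ne_zero (hnet : IsRayleighPoissonNetwork X h lam μ) :
    ∀ᵐ ω ∂μ, ∀ i, 0 < ‖X i ω‖ := by
  filter_upwards [hnet.poisson.ae_forall_notMem (A := {0}) (measurableSet_singleton _) (by simp)]
    with ω hω i
  exact norm_pos_iff.2 (hω i)

theorem IsRayleighPoissonNetwork.ae_summable_outerTerm
    (hnet : IsRayleighPoissonNetwork X h lam μ) (P : ℝ) {R : Ω → ℝ} (hR : ∀ᵐ ω ∂μ, 0 < R ω) :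
    ∀ᵐ ω ∂μ, Summable (outerTerm P 4 X h R ω) := by
  filter_upwards [hR, hnet.ae_summable_one_add_norm_rpow_mul] with ω hω hs
  refine Summable.of_norm_bounded (g := fun i =>
    |P| * ((1 + R ω) / R ω) ^ 4 * |(1 + ‖X i ω‖) ^ (-4 : ℝ) * h i ω|) (hs.abs.mul_left _)
    fun i => ?_
  rw [outerTerm]
  by_cases hi : R ω < ‖X i ω‖
  · rw [Set.indicator_of_mem (s := {j | R ω < ‖X j ω‖}) hi, avgPower, norm_mul, norm_mul,
      Real.norm_eq_abs, Real.norm_eq_abs, Real.norm_eq_abs, abs_mul,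
      abs_of_nonneg (a := (1 + ‖X i ω‖) ^ (-4 : ℝ)) (by positivity),
      abs_of_nonneg (a := ‖X i ω‖ ^ (-4 : ℝ)) (by positivity), Real.rpow_neg (norm_nonneg _),
      show (4 : ℝ) = (4 : ℕ) by norm_num, Real.rpow_natCast]
    have := inv_norm_pow_four_le hω hi
    rw [show (-4 : ℝ) = -(4 : ℕ) by norm_num] at this
    calc |P| * (‖X i ω‖ ^ 4)⁻¹ * |h i ω|
        ≤ |P| * (((1 + R ω) / R ω) ^ 4 * (1 + ‖X i ω‖) ^ (-(4 : ℕ) : ℝ)) * |h i ω| := by gcongr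
      _ = _ := by ring
  · rw [Set.indicator_of_notMem (s := {j | R ω < ‖X j ω‖}) hi, norm_zero]
    positivity

end Summability

/-! ### Nearest and second nearest points through counts. -/

section Geometry

/-- The point with index `k` is the strictly nearest one to the origin. -/
def IsNearest (x : ℕ → Plane) (k : ℕ) : Prop :=
  ∀ i, i ≠ k → ‖x k‖ < ‖x i‖

/-- The points with indices `j` and `k` are the strictly nearest and the strictly second nearest
one to the origin. -/
def IsSecondNearest (x : ℕ → Plane) (k j : ℕ) : Prop :=
  ‖x j‖ < ‖x k‖ ∧ ∀ i, i ≠ k → i ≠ j → ‖x k‖ < ‖x i‖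

theorem IsNearest.unique {x : ℕ → Plane} {k k' : ℕ} (h : IsNearest x k) (h' : IsNearest x k') :
    k = k' := by
  by_contra hne
  exact lt_asymm (h k' (Ne.symm hne)) (h' k hne)

theorem IsSecondNearest.isNearest {x : ℕ → Plane} {k j : ℕ} (h : IsSecondNearest x k j) :
    IsNearest x j := by
  intro i hi
  by_cases hik : i = k
  · rw [hik]; exact h.1
  · exact h.1.trans (h.2 i hik hi)

theorem IsSecondNearest.unique {x : ℕ → Plane} {k j k' j' : ℕ} (h : IsSecondNearest x k j)
    (h' : IsSecondNearest x k' j') : k = k' := by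
  have hj := h.isNearest.unique h'.isNearest
  subst hj
  by_contra hne
  have h1 : k' ≠ j := fun e => (e ▸ h'.1).false
  have h2 : k ≠ j := fun e => (e ▸ h.1).false
  exact lt_asymm (h.2 k' (Ne.symm hne) h1) (h'.2 k hne h2)

theorem IsNearest.norm_le_iff {x : ℕ → Plane} {k : ℕ} (h : IsNearest x k) (r : ℝ) :
    ‖x k‖ ≤ r ↔ 0 < pointCount x (Metric.closedBall 0 r) := by
  rw [pointCount, Set.encard_pos]
  constructor
  · intro hk
    exact ⟨k, by simpa using hk⟩
  · rintro ⟨i, hi⟩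
    have hi : ‖x i‖ ≤ r := by simpa using hi
    by_cases hik : i = k
    · exact hik ▸ hi
    · exact (h i hik).le.trans hi

/-- Together with `IsNearest.norm_le_iff`, this turns the serving distance into a threshold on the
count of a disc, the form in which Poisson independence applies. -/
theorem IsSecondNearest.norm_le_iff {x : ℕ → Plane} {k j : ℕ} (h : IsSecondNearest x k j)
    (r : ℝ) : ‖x k‖ ≤ r ↔ 1 < pointCount x (Metric.closedBall 0 r) := by
  rw [pointCount, Set.one_lt_encard_iff]
  constructor
  · intro hk
    refine ⟨k, j, by simpa using hk, by simpa using h.1.le.trans hk, fun e => ?_⟩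
    exact (e ▸ h.1).false
  · rintro ⟨a, b, ha, hb, hab⟩
    have ha : ‖x a‖ ≤ r := by simpa using ha
    have hb : ‖x b‖ ≤ r := by simpa using hb
    have key : ∀ i, i ≠ j → ‖x i‖ ≤ r → ‖x k‖ ≤ r := by
      intro i hi hir
      by_cases hik : i = k
      · exact hik ▸ hir
      · exact (h.2 i hik hi).le.trans hir
    by_cases haj : a = j
    · exact key b (fun e => hab (haj.trans e.symm)) hb
    · exact key a haj ha

/-- The position of the skipped point and the distance of the second nearest point, in terms of
the number of points in subsets of a disc. -/
theorem IsSecondNearest.lt_norm_and_mem_iff {x : ℕ → Plane} {k j : ℕ}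
    (h : IsSecondNearest x k j) {r : ℝ} {A : Set Plane} (hA : A ⊆ Metric.closedBall 0 r) :
    (r < ‖x k‖ ∧ x j ∈ A) ↔
      pointCount x A = 1 ∧ pointCount x (Metric.closedBall 0 r \ A) = 0 := by
  have hball : ∀ i, x i ∈ Metric.closedBall (0 : Plane) r ↔ ‖x i‖ ≤ r := by simp
  simp only [pointCount, Set.encard_eq_one, Set.encard_eq_zero]
  constructor
  · rintro ⟨hr, hj⟩
    have key : ∀ i, ‖x i‖ ≤ r → i = j := by
      intro i hi
      by_contra hij
      by_cases hik : i = k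
      · exact (hr.trans_le (hik ▸ hi)).false
      · exact ((hr.trans (h.2 i hik hij)).trans_le hi).false
    refine ⟨⟨j, Set.eq_singleton_iff_unique_mem.2 ⟨hj, fun i hi => key i ?_⟩⟩,
      Set.eq_empty_iff_forall_notMem.2 fun i hi => hi.2 ?_⟩
    · exact (hball i).1 (hA hi)
    · rw [key i ((hball i).1 hi.1)]; exact hj
  · rintro ⟨⟨i, hi⟩, hemp⟩
    have hiA : x i ∈ A := by
      have : i ∈ {i | x i ∈ A} := hi ▸ Set.mem_singleton i
      exact this
    have hinA : ∀ l, ‖x l‖ ≤ r → l = i := by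
      intro l hl
      have hlA : l ∈ {i | x i ∈ A} := by
        by_contra hlA
        have : l ∈ {i | x i ∈ Metric.closedBall 0 r \ A} := ⟨(hball l).2 hl, hlA⟩
        rw [hemp] at this
        exact this
      rw [hi] at hlA
      exact hlA
    have hij : j = i := by
      by_contra hij
      exact hij (hinA j ((h.isNearest i (Ne.symm hij)).le.trans ((hball i).1 (hA hiA))))
    refine ⟨?_, hij ▸ hiA⟩
    by_contra hr
    have hki := hinA k (not_lt.1 hr)
    exact (h.1.trans_eq (by rw [hki, hij])).false

theorem measurableSet_isNearest (k : ℕ) : MeasurableSet {x : ℕ → Plane | IsNearest x k} := by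
  have : {x : ℕ → Plane | IsNearest x k} =
      ⋂ i, ⋂ _ : i ≠ k, {x : ℕ → Plane | ‖x k‖ < ‖x i‖} := by
    ext x; simp [IsNearest]
  rw [this]
  exact .iInter fun i => .iInter fun _ =>
    measurableSet_lt (measurable_pi_apply k).norm (measurable_pi_apply i).norm

theorem measurableSet_isSecondNearest (k j : ℕ) :
    MeasurableSet {x : ℕ → Plane | IsSecondNearest x k j} := by
  have : {x : ℕ → Plane | IsSecondNearest x k j} = {x : ℕ → Plane | ‖x j‖ < ‖x k‖} ∩
      ⋂ i, ⋂ _ : i ≠ k, ⋂ _ : i ≠ j, {x : ℕ → Plane | ‖x k‖ < ‖x i‖} := by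
    ext x; simp [IsSecondNearest]
  rw [this]
  exact (measurableSet_lt (measurable_pi_apply j).norm (measurable_pi_apply k).norm).inter
    (.iInter fun i => .iInter fun _ => .iInter fun _ =>
    measurableSet_lt (measurable_pi_apply k).norm (measurable_pi_apply i).norm)

/-- A random index characterized by an event about the points is a measurable function of them. -/
theorem exists_measurable_index {Ω 𝓧 : Type*} [MeasurableSpace Ω] [MeasurableSpace 𝓧]
    {μ : Measure Ω} {ξ : Ω → 𝓧} {b : Ω → ℕ} {D : ℕ → Set 𝓧} (hD : ∀ k, MeasurableSet (D k))
    (h : ∀ᵐ ω ∂μ, ∀ k, ξ ω ∈ D k ↔ k = b ω) :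
    ∃ β : 𝓧 → ℕ, Measurable β ∧ ∀ᵐ ω ∂μ, β (ξ ω) = b ω := by
  classical
  -- The complement makes the search succeed everywhere; configurations in no `D k` receive the
  -- index 0.
  set p : 𝓧 → ℕ → Prop := fun x k => x ∈ D k ∪ (⋃ j, D j)ᶜ with hp
  have hex : ∀ x, ∃ k, p x k := by
    intro x
    by_cases hx : ∃ k, x ∈ D k
    · obtain ⟨k, hk⟩ := hx; exact ⟨k, Or.inl hk⟩
    · exact ⟨0, Or.inr (by simpa using hx)⟩
  refine ⟨fun x => Nat.find (hex x), measurable_find hex fun k =>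
    (hD k).union (MeasurableSet.iUnion hD).compl, ?_⟩
  filter_upwards [h] with ω hω
  rcases Nat.find_spec (hex (ξ ω)) with h1 | h1
  · exact (hω _).1 h1
  · exact absurd (Set.mem_iUnion.2 ⟨b ω, (hω _).2 rfl⟩) h1

/-- The gains are independent of the configuration, not a priori of the index `b`; expressing `b`
through the configuration allows the weights to depend on it. -/
theorem exists_measurable_nearest_index {Ω : Type*} [MeasurableSpace Ω] {μ : Measure Ω}
    {X : ℕ → Ω → Plane} {b : Ω → ℕ} (h : ∀ᵐ ω ∂μ, IsNearest (fun i => X i ω) (b ω)) :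
    ∃ β : (ℕ → Plane) → ℕ, Measurable β ∧ ∀ᵐ ω ∂μ, β (fun i => X i ω) = b ω := by
  refine exists_measurable_index (D := fun k => {x | IsNearest x k}) measurableSet_isNearest ?_
  filter_upwards [h] with ω hω k
  exact ⟨fun hk => hk.unique hω, fun hk => by rw [hk]; exact hω⟩

theorem exists_measurable_secondNearest_index {Ω : Type*} [MeasurableSpace Ω] {μ : Measure Ω}
    {X : ℕ → Ω → Plane} {b b' : Ω → ℕ}
    (h : ∀ᵐ ω ∂μ, IsSecondNearest (fun i => X i ω) (b ω) (b' ω)) :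
    ∃ β : (ℕ → Plane) → ℕ, Measurable β ∧ ∀ᵐ ω ∂μ, β (fun i => X i ω) = b ω := by
  refine exists_measurable_index (D := fun k => ⋃ j, {x | IsSecondNearest x k j})
    (fun k => .iUnion fun j => measurableSet_isSecondNearest k j) ?_
  filter_upwards [h] with ω hω k
  rw [Set.mem_iUnion]
  constructor
  · rintro ⟨j, hj⟩
    have hj : IsSecondNearest (fun i => X i ω) k j := hj
    exact hj.unique hω
  · intro hk
    exact ⟨b' ω, by rw [hk]; exact hω⟩

theorem avgPower_lt_avgPower_iff {P η a b : ℝ} (hP : 0 < P) (hη : 0 < η) (ha : 0 < a)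
    (hb : 0 < b) : avgPower P η a < avgPower P η b ↔ b < a := by
  rw [avgPower, avgPower, mul_lt_mul_iff_right₀ hP,
    Real.rpow_lt_rpow_iff_of_neg ha hb (neg_lt_zero.2 hη)]

variable {Ω : Type*} [MeasurableSpace Ω] {X : ℕ → Ω → Plane} {h : ℕ → Ω → ℝ} {lam P : ℝ}
  {μ : Measure Ω} {b₀ b₁ : Ω → ℕ}

theorem IsBestConnected.ae_isNearest (hb : IsBestConnected P 4 X b₀ μ)
    (hnet : IsRayleighPoissonNetwork X h lam μ) (hP : 0 < P) :
    ∀ᵐ ω ∂μ, IsNearest (fun i => X i ω) (b₀ ω) := by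
  filter_upwards [hb.2, hnet.ae_ne_zero] with ω h1 h2 i hi
  exact (avgPower_lt_avgPower_iff hP (by norm_num) (h2 i) (h2 _)).1 (h1 i hi)

theorem IsBlackout.ae_isSecondNearest (hb : IsBlackout P 4 X b₀ b₁ μ)
    (hnet : IsRayleighPoissonNetwork X h lam μ) (hP : 0 < P) :
    ∀ᵐ ω ∂μ, IsSecondNearest (fun i => X i ω) (b₀ ω) (b₁ ω) := by
  filter_upwards [hb.2.2, hnet.ae_ne_zero] with ω h1 h2
  refine ⟨(avgPower_lt_avgPower_iff hP (by norm_num) (h2 _) (h2 _)).1 h1.1, fun i hi hi' => ?_⟩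
  exact (avgPower_lt_avgPower_iff hP (by norm_num) (h2 i) (h2 _)).1 (h1.2 i hi hi')

theorem measurable_apply_index {α : Type*} [MeasurableSpace α] {Y : ℕ → α → Plane} {b : α → ℕ}
    (hY : ∀ i, Measurable (Y i)) (hb : Measurable b) : Measurable fun a => Y (b a) a :=
  (measurable_from_prod_countable_right (f := fun p : ℕ × α => Y p.1 p.2) hY).comp
    (hb.prodMk measurable_id)

end Geometry

/-! ### From integrals over events to the conditional law. -/

section ConditionalLaplace

variable {Ω : Type*} [MeasurableSpace Ω] {μ : Measure Ω} [IsProbabilityMeasure μ]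

/-- Every event of σ(R) is some {R ∈ B}, so the hypothesis says that g(R) is the conditional
expectation of exp(-s(R) I). Disintegration along R computes the same conditional expectation by
`condDistrib`. -/
theorem ae_condLaplace_eq {I R : Ω → ℝ} (hI : AEMeasurable I μ) (hR : Measurable R)
    (hI0 : ∀ᵐ ω ∂μ, 0 ≤ I ω) {s g : ℝ → ℝ} (hs : Measurable s) (hs0 : ∀ r, 0 ≤ s r)
    (hg : Measurable g) (hgint : Integrable (fun ω => g (R ω)) μ)
    (h : ∀ B, MeasurableSet B →
      ∫ ω in R ⁻¹' B, Real.exp (-(s (R ω) * I ω)) ∂μ = ∫ ω in R ⁻¹' B, g (R ω) ∂μ) :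
    ∀ᵐ ρ ∂(μ.map R), condLaplace I R μ (s ρ) ρ = g ρ := by
  set f : ℝ × ℝ → ℝ := fun p => Real.exp (-(s p.1 * p.2)) with hf
  have hfm : Measurable f := by fun_prop
  have hfint : Integrable (fun ω => f (R ω, I ω)) μ := by
    refine Integrable.of_bound
      (hfm.comp_aemeasurable (hR.aemeasurable.prodMk hI)).aestronglyMeasurable 1 ?_
    filter_upwards [hI0] with ω hω
    rw [hf, Real.norm_of_nonneg (Real.exp_nonneg _), Real.exp_le_one_iff, neg_nonpos]
    exact mul_nonneg (hs0 _) hω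
  have h1 := condExp_prod_ae_eq_integral_condDistrib hR hI hfm.stronglyMeasurable hfint
  have h2 : (fun ω => g (R ω)) =ᵐ[μ]
      μ[fun ω => f (R ω, I ω) | MeasurableSpace.comap R inferInstance] := by
    refine ae_eq_condExp_of_forall_setIntegral_eq hR.comap_le hfint
      (fun _ _ _ => hgint.integrableOn) ?_ ?_
    · rintro _ ⟨B, hB, rfl⟩ _
      exact (h B hB).symm
    · exact (hg.comp (comap_measurable R)).aestronglyMeasurable
  have h3 : MeasurableSet {ρ | condLaplace I R μ (s ρ) ρ = g ρ} := by
    refine measurableSet_eq_fun ?_ hg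
    exact (hfm.stronglyMeasurable.integral_condDistrib (X := R) (Y := I) (μ := μ)).measurable
  rw [ae_map_iff hR.aemeasurable h3]
  filter_upwards [h1, h2] with ω h4 h5
  exact h4.symm.trans h5.symm

end ConditionalLaplace

/-! ### Interference from outside the serving disc. -/

section Interference

open Filter Topology

variable {Ω : Type*} [MeasurableSpace Ω] {X : ℕ → Ω → Plane} {h : ℕ → Ω → ℝ} {lam P T : ℝ}
  {μ : Measure Ω} {b₀ b₁ : Ω → ℕ}

/-- The cutoff is strict, so the weight is continuous from the right in the radius, even at r = ‖x‖
where the serving point sits. From the left it would jump there, which is why the right endpoint of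
the cell is used. -/
theorem tendsto_outerWeight_of_ge (T : ℝ) {r : ℝ} {v : ℕ → ℝ} (hv : ∀ n, r ≤ v n)
    (hlim : Tendsto v atTop (𝓝 r)) (x : Plane) :
    Tendsto (fun n => outerWeight T (v n) x) atTop (𝓝 (outerWeight T r x)) := by
  by_cases hx : r < ‖x‖
  · have h1 : outerWeight T r x = T * r ^ 4 / ‖x‖ ^ 4 :=
      Set.indicator_of_mem (s := {x : Plane | r < ‖x‖}) hx _
    rw [h1]
    refine (((hlim.pow 4).const_mul T).div_const _).congr' ?_
    filter_upwards [hlim.eventually_lt_const hx] with n hn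
    exact (Set.indicator_of_mem (s := {x : Plane | v n < ‖x‖}) hn
      fun x => T * v n ^ 4 / ‖x‖ ^ 4).symm
  · have h1 : ∀ s, r ≤ s → outerWeight T s x = 0 := fun s hs =>
      Set.indicator_of_notMem (s := {x : Plane | s < ‖x‖}) (fun h => hx (hs.trans_lt h))
        fun x => T * s ^ 4 / ‖x‖ ^ 4
    rw [h1 r le_rfl]
    simp only [h1 _ (hv _)]
    exact tendsto_const_nhds

theorem outerWeight_le {r s M : ℝ} (hT : 0 ≤ T) (hr : 0 < r) (hrs : r ≤ s) (hsM : s ≤ M)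
    (x : Plane) : outerWeight T s x ≤ (M / r) ^ 4 * outerWeight T r x := by
  by_cases hx : s < ‖x‖
  · have h1 : ∀ t, t ≤ s → outerWeight T t x = T * t ^ 4 / ‖x‖ ^ 4 := fun t ht =>
      Set.indicator_of_mem (s := {x : Plane | t < ‖x‖}) (ht.trans_lt hx) _
    have hs : 0 ≤ s := hr.le.trans hrs
    rw [h1 s le_rfl, h1 r hrs]
    calc T * s ^ 4 / ‖x‖ ^ 4 ≤ T * M ^ 4 / ‖x‖ ^ 4 := by gcongr
      _ = (M / r) ^ 4 * (T * r ^ 4 / ‖x‖ ^ 4) := by field_simp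
  · have h1 : outerWeight T s x = 0 :=
      Set.indicator_of_notMem (s := {x : Plane | s < ‖x‖}) hx _
    rw [h1]
    exact mul_nonneg (by positivity) (outerWeight_nonneg hT _ _)

theorem log_one_add_outerWeight_nonneg (hT : 0 ≤ T) (r : ℝ) (x : Plane) :
    0 ≤ Real.log (1 + outerWeight T r x) :=
  Real.log_nonneg (by linarith [outerWeight_nonneg hT r x])

theorem tendsto_tsum_log_outerWeight (hT : 0 ≤ T) {r : ℝ} (hr : 0 < r) {v : ℕ → ℝ}
    (hv : ∀ n, r ≤ v n) (hlim : Tendsto v atTop (𝓝 r)) {x : ℕ → Plane}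
    (hx : Summable fun i => (1 + ‖x i‖) ^ (-4 : ℝ)) :
    Tendsto (fun n => ∑' i, Real.log (1 + outerWeight T (v n) (x i))) atTop
      (𝓝 (∑' i, Real.log (1 + outerWeight T r (x i)))) := by
  refine tendsto_tsum_of_dominated_convergence
    ((summable_outerWeight hT hr hx).mul_left (((r + 1) / r) ^ 4)) (fun i => ?_) ?_
  · refine ((tendsto_outerWeight_of_ge T hv hlim (x i)).const_add 1).log ?_
    linarith [outerWeight_nonneg hT r (x i)]
  · filter_upwards [hlim.eventually_le_const (lt_add_one r)] with n hn i
    rw [Real.norm_of_nonneg (log_one_add_outerWeight_nonneg hT _ _)]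
    refine le_trans ?_ (outerWeight_le hT hr (hv n) hn (x i))
    have := outerWeight_nonneg hT (v n) (x i)
    linarith [Real.log_le_sub_one_of_pos (x := 1 + outerWeight T (v n) (x i)) (by linarith)]

/-- The weight with cutoff s vanishes on the closed disc of radius a ≤ s, so the exponential is
independent of the count there and the Laplace functional factors. -/
theorem IsRayleighPoissonNetwork.setIntegral_exp_neg_tsum_log_outerWeight_of_count
    (hnet : IsRayleighPoissonNetwork X h lam μ) (hlam : 0 < lam) (hT : 0 < T) {a s : ℝ}
    (has : a ≤ s) (hs : 0 < s) {A : Set Ω} {S : Set ℕ∞}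
    (hA : ∀ᵐ ω ∂μ, ω ∈ A ↔ pointCount (fun i => X i ω) (Metric.closedBall 0 a) ∈ S)
    (hAm : MeasurableSet A) :
    ∫ ω in A, Real.exp (-∑' i, Real.log (1 + outerWeight T s (X i ω))) ∂μ =
      ∫ _ in A, Real.exp (-(Real.pi * lam * s ^ 2 * (√T * Real.arctan √T))) ∂μ := by
  have hw : Measurable (outerWeight T s) :=
    (measurable_outerWeight T).comp (measurable_const.prodMk measurable_id)
  have hval := integral_one_sub_exp_neg_log_outerWeight hT hs
  have hpos : 0 < Real.pi * s ^ 2 * (√T * Real.arctan √T) := by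
    have : 0 < √T := Real.sqrt_pos.2 hT
    have := Real.arctan_pos.2 this
    positivity
  have hint : Integrable (fun x => 1 - Real.exp (-Real.log (1 + outerWeight T s x)))
      (volume : Measure Plane) := by
    -- A nonintegrable function would have integral 0, contradicting the positive value just
    -- computed.
    by_contra hni
    rw [integral_undef hni] at hval
    exact hpos.ne hval
  have key := hnet.poisson.laplace_functional (D := Metric.closedBall 0 a)
    measurableSet_closedBall S (f := fun x => Real.log (1 + outerWeight T s x))
    (measurable_const.add hw).log (fun x => log_one_add_outerWeight_nonneg hT.le _ _)
    (fun x hx => ?_) (hint.smul_measure ENNReal.ofReal_ne_top) ?_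
  · rw [integral_smul_measure, hval, ENNReal.toReal_ofReal hlam.le, smul_eq_mul] at key
    have hμ : μ.real {ω | pointCount (fun i => X i ω) (Metric.closedBall 0 a) ∈ S} = μ.real A := by
      refine measureReal_congr ?_
      filter_upwards [hA] with ω hω using propext hω.symm
    rw [setIntegral_const, smul_eq_mul, ← hμ,
      show Real.pi * lam * s ^ 2 * (√T * Real.arctan √T) =
        lam * (Real.pi * s ^ 2 * (√T * Real.arctan √T)) by ring, ← key,
      ← integral_indicator hAm]
    refine integral_congr_ae ?_
    filter_upwards [hA] with ω hω
    by_cases h1 : ω ∈ A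
    · rw [Set.indicator_of_mem h1, Set.indicator_of_mem (hω.1 h1), one_mul]
    · rw [Set.indicator_of_notMem h1, Set.indicator_of_notMem fun h2 => h1 (hω.2 h2), zero_mul]
  · have h1 : outerWeight T s x = 0 := by
      refine Set.indicator_of_notMem (s := {x : Plane | s < ‖x‖}) (fun h => ?_) _
      have h2 : ‖x‖ ≤ a := by simpa using hx
      exact (h.trans_le (h2.trans has)).false
    rw [h1, add_zero, Real.log_one]
  · filter_upwards [hnet.ae_summable_one_add_norm_rpow] with ω hω
    exact summable_log_one_add (fun i => outerWeight_nonneg hT.le _ _)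
      (summable_outerWeight hT.le hs hω)

/-- Conditionally on the distance `R` of the `m`-th nearest point, the points farther away form a
Poisson point process. -/
theorem IsRayleighPoissonNetwork.setIntegral_exp_neg_tsum_log_outerWeight
    (hnet : IsRayleighPoissonNetwork X h lam μ) (hlam : 0 < lam) (hT : 0 < T) {R : Ω → ℝ}
    (hR : Measurable R) (hpos : ∀ᵐ ω ∂μ, 0 < R ω) {m : ℕ∞}
    (hcount : ∀ᵐ ω ∂μ, ∀ r, R ω ≤ r ↔ m < pointCount (fun i => X i ω) (Metric.closedBall 0 r))
    {B : Set ℝ} (hB : MeasurableSet B) :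
    ∫ ω in R ⁻¹' B, Real.exp (-∑' i, Real.log (1 + outerWeight T (R ω) (X i ω))) ∂μ =
      ∫ ω in R ⁻¹' B, Real.exp (-(Real.pi * lam * R ω ^ 2 * (√T * Real.arctan √T))) ∂μ := by
  have := hnet.poisson.isProbabilityMeasure
  have hc : 0 ≤ √T * Real.arctan √T :=
    mul_nonneg (Real.sqrt_nonneg _) (Real.arctan_nonneg.2 (Real.sqrt_nonneg _))
  have hFm : ∀ s, Measurable fun ω =>
      Real.exp (-∑' i, Real.log (1 + outerWeight T s (X i ω))) := fun s =>
    (Measurable.tsum fun i => (measurable_const.add ((measurable_outerWeight T).comp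
      (measurable_const.prodMk (hnet.poisson.measurable_point i)))).log).neg.exp
  have hF01 : ∀ s ω, Real.exp (-∑' i, Real.log (1 + outerWeight T s (X i ω))) ∈
      Set.Icc (0 : ℝ) 1 := fun s ω => ⟨Real.exp_nonneg _, Real.exp_le_one_iff.2
    (neg_nonpos.2 (tsum_nonneg fun i => log_one_add_outerWeight_nonneg hT.le _ _))⟩
  refine setIntegral_eq_of_cells hR hpos
    (F := fun _ s ω => Real.exp (-∑' i, Real.log (1 + outerWeight T s (X i ω))))
    (G := fun _ s _ => Real.exp (-(Real.pi * lam * s ^ 2 * (√T * Real.arctan √T))))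
    (fun _ s => hFm s) (fun _ _ => measurable_const) (fun _ s ω => hF01 s ω)
    (fun _ s _ => ⟨Real.exp_nonneg _, Real.exp_le_one_iff.2 (neg_nonpos.2 (by positivity))⟩)
    (fun r s hr hrs => ?_) ?_ ?_ hB
  · have hs : 0 < s := hr.trans_lt hrs
    -- Both events are count events in discs of radius at most s, so the same fixed cutoff s serves
    -- for both and the identities subtract.
    have hset : {ω | r < R ω ∧ R ω ≤ s} = {ω | R ω ≤ s} \ {ω | R ω ≤ r} := by
      ext ω; simp [and_comm]
    have hle : ∀ a, MeasurableSet {ω | R ω ≤ a} := fun a => measurableSet_le hR measurable_const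
    have hsub : {ω | R ω ≤ r} ⊆ {ω | R ω ≤ s} := fun ω hω => le_trans hω hrs.le
    have hcell : ∀ a, a ≤ s → ∫ ω in {ω | R ω ≤ a},
        Real.exp (-∑' i, Real.log (1 + outerWeight T s (X i ω))) ∂μ =
        ∫ _ in {ω | R ω ≤ a}, Real.exp (-(Real.pi * lam * s ^ 2 * (√T * Real.arctan √T))) ∂μ :=
      fun a ha => hnet.setIntegral_exp_neg_tsum_log_outerWeight_of_count hlam hT ha hs
        (S := Set.Ioi m) (hcount.mono fun ω hω => hω a) (hle a)
    rw [hset, setIntegral_sdiff (hle r) ?_ hsub,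
      setIntegral_sdiff (hle r) (integrable_const _).integrableOn hsub, hcell s le_rfl, hcell r hrs.le]
    refine (Integrable.of_bound (hFm s).aestronglyMeasurable 1
      (.of_forall fun ω => ?_)).integrableOn
    rw [Real.norm_of_nonneg (hF01 s ω).1]
    exact (hF01 s ω).2
  · filter_upwards [hpos, hnet.ae_summable_one_add_norm_rpow] with ω h1 h2 u v _ hv _ hvlim
    exact (Real.continuous_exp.tendsto _).comp
      (tendsto_tsum_log_outerWeight hT.le h1 hv hvlim h2).neg
  · refine .of_forall fun ω u v _ _ _ hvlim => ?_
    exact (Real.continuous_exp.tendsto _).comp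
      (((hvlim.pow 2).const_mul _).mul_const _).neg

theorem mul_avgPower_mul (hP : P ≠ 0) (T r a y : ℝ) (ha : 0 ≤ a) :
    T * r ^ 4 / P * (avgPower P 4 a * y) = T * r ^ 4 / a ^ 4 * y := by
  rw [avgPower, Real.rpow_neg ha, show (4 : ℝ) = (4 : ℕ) by norm_num, Real.rpow_natCast]
  field_simp

theorem aemeasurable_outerTerm (hnet : IsRayleighPoissonNetwork X h lam μ) {R : Ω → ℝ}
    (hR : Measurable R) (i : ℕ) : AEMeasurable (fun ω => outerTerm P 4 X h R ω i) μ := by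
  have hXi := hnet.poisson.measurable_point i
  have : (fun ω => outerTerm P 4 X h R ω i) =
      {ω | R ω < ‖X i ω‖}.indicator fun ω => avgPower P 4 ‖X i ω‖ * h i ω := by
    ext ω; rfl
  rw [this]
  refine AEMeasurable.indicator ?_ (measurableSet_lt hR hXi.norm)
  exact ((hXi.norm.pow_const _).const_mul P).aemeasurable.mul (hnet.gain_law i).aemeasurable

theorem avgPower_nonneg (hP : 0 ≤ P) {η a : ℝ} (ha : 0 ≤ a) : 0 ≤ avgPower P η a :=
  mul_nonneg hP (Real.rpow_nonneg ha _)

/-- The conditional Laplace transform of the interference from outside the disc reaching to the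
serving point. -/
theorem IsRayleighPoissonNetwork.ae_condLaplace_outerInterference [IsProbabilityMeasure μ]
    (hnet : IsRayleighPoissonNetwork X h lam μ) (hlam : 0 < lam) (hP : 0 < P) (hT : 0 < T)
    (hb : Measurable b₀) {m : ℕ∞}
    (hcount : ∀ᵐ ω ∂μ, ∀ r, bsDist X b₀ ω ≤ r ↔
      m < pointCount (fun i => X i ω) (Metric.closedBall 0 r))
    {β : (ℕ → Plane) → ℕ} (hβ : Measurable β) (hβb : ∀ᵐ ω ∂μ, β (fun i => X i ω) = b₀ ω) :
    ∀ᵐ ρ ∂(μ.map (bsDist X b₀)),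
      condLaplace (outerInterference P 4 X h (bsDist X b₀)) (bsDist X b₀) μ (T * ρ ^ 4 / P) ρ =
        Real.exp (-(Real.pi * lam * ρ ^ 2 * (√T * Real.arctan √T))) := by
  have hX := hnet.poisson.measurable_point
  have hR : Measurable (bsDist X b₀) := (measurable_apply_index hX hb).norm
  have hpos : ∀ᵐ ω ∂μ, 0 < bsDist X b₀ ω := hnet.ae_ne_zero.mono fun ω hω => hω _
  have hg : Measurable fun ρ : ℝ =>
      Real.exp (-(Real.pi * lam * ρ ^ 2 * (√T * Real.arctan √T))) := by fun_prop
  have hc : 0 ≤ √T * Real.arctan √T :=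
    mul_nonneg (Real.sqrt_nonneg _) (Real.arctan_nonneg.2 (Real.sqrt_nonneg _))
  refine ae_condLaplace_eq (s := fun ρ => T * ρ ^ 4 / P)
    (AEMeasurable.tsum fun i => aemeasurable_outerTerm hnet hR i) hR ?_ (by fun_prop)
    (fun r => by positivity) hg ?_ fun B hB => ?_
  · filter_upwards [ae_nonneg_gains hnet.gain_law] with ω hω
    exact tsum_nonneg fun i => Set.indicator_nonneg
      (fun j _ => mul_nonneg (avgPower_nonneg hP.le (norm_nonneg _)) (hω j)) i
  · refine Integrable.of_bound (hg.comp hR).aestronglyMeasurable 1 (.of_forall fun ω => ?_)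
    rw [Real.norm_of_nonneg (Real.exp_nonneg _), Real.exp_le_one_iff, neg_nonpos]
    positivity
  · rw [← hnet.setIntegral_exp_neg_tsum_log_outerWeight hlam hT hR hpos hcount hB]
    have hρ : Measurable fun x : ℕ → Plane => ‖x (β x)‖ :=
      (measurable_apply_index (fun i => measurable_pi_apply i) hβ).norm
    have hRρ : ∀ᵐ ω ∂μ, ‖X (β fun i => X i ω) ω‖ = bsDist X b₀ ω := by
      filter_upwards [hβb] with ω hω
      rw [hω, bsDist]
    -- Conditioning variable: the whole configuration. Through `β`, both the radius and the event {R
    -- ∈ B} become functions of it, up to null sets.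
    have key := setIntegral_exp_neg_tsum_gains (ξ := fun ω i => X i ω) (measurable_pi_iff.2 hX)
      hnet.gain_law hnet.gain_indep hnet.gain_indep_points
      (c := fun x i => outerWeight T ‖x (β x)‖ (x i))
      (fun i => (measurable_outerWeight T).comp (hρ.prodMk (measurable_pi_apply i)))
      (fun x i => outerWeight_nonneg hT.le _ _) ?_ (E := (fun x => ‖x (β x)‖) ⁻¹' B) (hρ hB)
    · have hpre : (fun ω i => X i ω) ⁻¹' ((fun x : ℕ → Plane => ‖x (β x)‖) ⁻¹' B) =ᵐ[μ]
          bsDist X b₀ ⁻¹' B := by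
        filter_upwards [hRρ] with ω hω
        change (‖X (β fun i => X i ω) ω‖ ∈ B) = (bsDist X b₀ ω ∈ B)
        rw [hω]
      rw [setIntegral_congr_set hpre, setIntegral_congr_set hpre] at key
      refine Eq.trans (Eq.trans ?_ key) ?_
      · refine integral_congr_ae (ae_restrict_of_ae ?_)
        filter_upwards [hRρ] with ω hω
        simp only [hω]
        rw [← tsum_mul_left]
        congr 2
        refine tsum_congr fun i => ?_
        by_cases hi : bsDist X b₀ ω < ‖X i ω‖
        · rw [outerTerm, outerWeight,
            Set.indicator_of_mem (s := {j | bsDist X b₀ ω < ‖X j ω‖}) hi,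
            Set.indicator_of_mem (s := {x : Plane | bsDist X b₀ ω < ‖x‖}) hi,
            mul_avgPower_mul hP.ne' _ _ _ _ (norm_nonneg _)]
        · rw [outerTerm, outerWeight,
            Set.indicator_of_notMem (s := {j | bsDist X b₀ ω < ‖X j ω‖}) hi,
            Set.indicator_of_notMem (s := {x : Plane | bsDist X b₀ ω < ‖x‖}) hi, mul_zero,
            zero_mul]
      · refine integral_congr_ae (ae_restrict_of_ae ?_)
        filter_upwards [hRρ] with ω hω
        simp only [hω]
    · filter_upwards [hRρ, hpos, hnet.ae_summable_one_add_norm_rpow] with ω h1 h2 h3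
      simp only [h1]
      exact summable_outerWeight hT.le h2 h3

end Interference

/-! ### Interference from the skipped point. -/

section Skipped

open Filter Topology

variable {Ω : Type*} [MeasurableSpace Ω] {X : ℕ → Ω → Plane} {h : ℕ → Ω → ℝ} {lam P T : ℝ}
  {Λ : Measure Plane} {μ : Measure Ω} {b₀ b₁ : Ω → ℕ}

/-- The joint law of the nearest point and the distance of the second nearest one. -/
theorem IsPoissonPointProcess.measureReal_lt_and_mem [IsFiniteMeasureOnCompacts Λ]
    (hX : IsPoissonPointProcess X Λ μ)
    (hsec : ∀ᵐ ω ∂μ, IsSecondNearest (fun i => X i ω) (b₀ ω) (b₁ ω)) {r : ℝ} {A : Set Plane}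
    (hA : MeasurableSet A) (hAr : A ⊆ Metric.closedBall 0 r) :
    μ.real {ω | r < bsDist X b₀ ω ∧ X (b₁ ω) ω ∈ A} =
      Λ.real A * Real.exp (-Λ.real (Metric.closedBall 0 r)) := by
  have := hX.isProbabilityMeasure
  have hball : Λ (Metric.closedBall 0 r) ≠ ⊤ := (isCompact_closedBall _ _).measure_ne_top
  have hD : MeasurableSet (Metric.closedBall 0 r \ A) := measurableSet_closedBall.diff hA
  have hAtop : Λ A ≠ ⊤ := ne_top_of_le_ne_top hball (measure_mono hAr)
  have hDtop : Λ (Metric.closedBall 0 r \ A) ≠ ⊤ :=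
    ne_top_of_le_ne_top hball (measure_mono Set.sdiff_subset)
  have h1 : μ.real {ω | r < bsDist X b₀ ω ∧ X (b₁ ω) ω ∈ A} =
      μ.real ({ω | pointCount (fun i => X i ω) A = (1 : ℕ)} ∩
        {ω | pointCount (fun i => X i ω) (Metric.closedBall 0 r \ A) = (0 : ℕ)}) := by
    refine measureReal_congr ?_
    filter_upwards [hsec] with ω hω
    have h2 := hω.lt_norm_and_mem_iff hAr
    rw [← Nat.cast_one, ← Nat.cast_zero] at h2
    exact propext h2
  have hind := (hX.indep_count 2 ![A, Metric.closedBall 0 r \ A]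
    (by intro j; fin_cases j <;> assumption) (by
      intro i j hij
      fin_cases i <;> fin_cases j
      · exact absurd rfl hij
      · exact Set.disjoint_sdiff_right
      · exact Set.disjoint_sdiff_left
      · exact absurd rfl hij)).indepFun (i := 0) (j := 1) (by simp)
  have h2 := hind.measure_inter_preimage_eq_mul {((1 : ℕ) : ℕ∞)} {((0 : ℕ) : ℕ∞)}
    (.of_discrete) (.of_discrete)
  have h3 : μ ({ω | pointCount (fun i => X i ω) A = (1 : ℕ)} ∩
      {ω | pointCount (fun i => X i ω) (Metric.closedBall 0 r \ A) = (0 : ℕ)}) =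
      μ {ω | pointCount (fun i => X i ω) A = (1 : ℕ)} *
        μ {ω | pointCount (fun i => X i ω) (Metric.closedBall 0 r \ A) = (0 : ℕ)} := h2
  rw [h1, measureReal_def, h3, ENNReal.toReal_mul, hX.poisson_count A hA hAtop,
    hX.poisson_count _ hD hDtop, ← measureReal_def, ← measureReal_def,
    poissonMeasure_real_singleton, poissonMeasure_real_singleton]
  -- The factors Λ(A) exp(-Λ(A)) for one point and exp(-Λ(disc \ A)) for none combine their
  -- exponents into that of the whole disc.
  have h4 : Λ.real A + Λ.real (Metric.closedBall 0 r \ A) = Λ.real (Metric.closedBall 0 r) := by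
    rw [measureReal_sdiff hAr hA hball]; ring
  rw [← h4, neg_add, Real.exp_add]
  simp [Measure.real, ENNReal.toReal]
  ring

/-- Subtracting the joint law at s from that at r shows that, on the cell, the nearest point
restricted to the inner disc has law a constant multiple of Λ. The restriction is needed because on
the cell the nearest point may also lie between r and s. -/
theorem IsPoissonPointProcess.setIntegral_nearest [IsFiniteMeasureOnCompacts Λ]
    (hX : IsPoissonPointProcess X Λ μ) (hb₀ : Measurable b₀) (hb₁ : Measurable b₁)
    (hsec : ∀ᵐ ω ∂μ, IsSecondNearest (fun i => X i ω) (b₀ ω) (b₁ ω)) {r s : ℝ} (hrs : r ≤ s)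
    {g : Plane → ℝ} (hg : Measurable g) :
    ∫ ω in {ω | r < bsDist X b₀ ω ∧ bsDist X b₀ ω ≤ s},
        (Metric.closedBall 0 r).indicator g (X (b₁ ω) ω) ∂μ =
      (Real.exp (-Λ.real (Metric.closedBall 0 r)) -
        Real.exp (-Λ.real (Metric.closedBall 0 s))) * ∫ x in Metric.closedBall 0 r, g x ∂Λ := by
  have := hX.isProbabilityMeasure
  set K := Real.exp (-Λ.real (Metric.closedBall 0 r)) -
    Real.exp (-Λ.real (Metric.closedBall 0 s)) with hK
  have hball : ∀ t : ℝ, Λ (Metric.closedBall 0 t) ≠ ⊤ :=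
    fun t => (isCompact_closedBall _ _).measure_ne_top
  have hsub : Metric.closedBall (0 : Plane) r ⊆ Metric.closedBall 0 s :=
    Metric.closedBall_subset_closedBall hrs
  have hK0 : 0 ≤ K := sub_nonneg.2 (Real.exp_le_exp.2 (neg_le_neg
    (measureReal_mono hsub (hball s))))
  have hR : Measurable (bsDist X b₀) := (measurable_apply_index hX.measurable_point hb₀).norm
  have hY : Measurable fun ω => X (b₁ ω) ω := measurable_apply_index hX.measurable_point hb₁
  have hlaw : ((μ.restrict {ω | r < bsDist X b₀ ω ∧ bsDist X b₀ ω ≤ s}).map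
      fun ω => X (b₁ ω) ω).restrict (Metric.closedBall 0 r) =
      ENNReal.ofReal K • Λ.restrict (Metric.closedBall 0 r) := by
    ext A hA
    have hAm : MeasurableSet (A ∩ Metric.closedBall (0 : Plane) r) :=
      hA.inter measurableSet_closedBall
    have hAtop : Λ (A ∩ Metric.closedBall 0 r) ≠ ⊤ :=
      ne_top_of_le_ne_top (hball r) (measure_mono Set.inter_subset_right)
    rw [Measure.smul_apply, smul_eq_mul, Measure.restrict_apply hA, Measure.restrict_apply hA,
      Measure.map_apply hY hAm, Measure.restrict_apply (hY hAm)]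
    have hset : (fun ω => X (b₁ ω) ω) ⁻¹' (A ∩ Metric.closedBall 0 r) ∩
        {ω | r < bsDist X b₀ ω ∧ bsDist X b₀ ω ≤ s} =
        {ω | r < bsDist X b₀ ω ∧ X (b₁ ω) ω ∈ A ∩ Metric.closedBall 0 r} \
          {ω | s < bsDist X b₀ ω ∧ X (b₁ ω) ω ∈ A ∩ Metric.closedBall 0 r} := by
      ext ω
      simp only [Set.mem_inter_iff, Set.mem_preimage, Set.mem_ofPred_eq, Set.mem_sdiff]
      grind
    have hreal : μ.real ((fun ω => X (b₁ ω) ω) ⁻¹' (A ∩ Metric.closedBall 0 r) ∩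
        {ω | r < bsDist X b₀ ω ∧ bsDist X b₀ ω ≤ s}) = K * Λ.real (A ∩ Metric.closedBall 0 r) := by
      rw [hset, measureReal_sdiff, hX.measureReal_lt_and_mem hsec hAm Set.inter_subset_right,
        hX.measureReal_lt_and_mem hsec hAm (Set.inter_subset_right.trans hsub), hK]
      · ring
      · exact fun ω hω => ⟨hrs.trans_lt hω.1, hω.2⟩
      · exact (measurableSet_lt measurable_const hR).inter (hY hAm)
    rw [← ENNReal.ofReal_toReal (measure_ne_top μ _), ← measureReal_def, hreal,
      ENNReal.ofReal_mul hK0, measureReal_def, ENNReal.ofReal_toReal hAtop]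
  rw [← integral_map (f := (Metric.closedBall 0 r).indicator g) hY.aemeasurable
    (hg.indicator measurableSet_closedBall).aestronglyMeasurable,
    integral_indicator measurableSet_closedBall, hlaw, integral_smul_measure,
    ENNReal.toReal_ofReal hK0, smul_eq_mul]

/-- Conditionally on the distance of the second nearest point, the squared ratio of the distances
of the two nearest points is uniform on the unit interval. -/
theorem IsRayleighPoissonNetwork.setIntegral_inv_one_add_nearest
    (hnet : IsRayleighPoissonNetwork X h lam μ) (hT : 0 < T)
    (hb₀ : Measurable b₀) (hb₁ : Measurable b₁)
    (hsec : ∀ᵐ ω ∂μ, IsSecondNearest (fun i => X i ω) (b₀ ω) (b₁ ω))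
    {B : Set ℝ} (hB : MeasurableSet B) :
    ∫ ω in bsDist X b₀ ⁻¹' B, (1 + T * bsDist X b₀ ω ^ 4 / ‖X (b₁ ω) ω‖ ^ 4)⁻¹ ∂μ =
      ∫ _ in bsDist X b₀ ⁻¹' B, (1 - √T * Real.arctan (1 / √T)) ∂μ := by
  have := hnet.poisson.isProbabilityMeasure
  have hX := hnet.poisson.measurable_point
  have hR : Measurable (bsDist X b₀) := (measurable_apply_index hX hb₀).norm
  have hY : Measurable fun ω => X (b₁ ω) ω := measurable_apply_index hX hb₁
  have hC0 : 0 ≤ 1 - √T * Real.arctan (1 / √T) := sub_nonneg.2 (mul_arctan_one_div_le_one hT)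
  have hC1 : 1 - √T * Real.arctan (1 / √T) ≤ 1 := by
    have : 0 ≤ √T * Real.arctan (1 / √T) :=
      mul_nonneg (Real.sqrt_nonneg _) (Real.arctan_nonneg.2 (by positivity))
    linarith
  have hg : ∀ r : ℝ, Measurable fun x : Plane => (1 + T * r ^ 4 / ‖x‖ ^ 4)⁻¹ := fun r => by
    fun_prop
  have h01 : ∀ (r : ℝ) {g : Plane → ℝ}, (∀ x, g x ∈ Set.Icc (0 : ℝ) 1) → ∀ x,
      (Metric.closedBall 0 r).indicator g x ∈ Set.Icc (0 : ℝ) 1 := by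
    intro r g hg x
    by_cases hx : x ∈ Metric.closedBall (0 : Plane) r
    · rw [Set.indicator_of_mem hx]; exact hg x
    · rw [Set.indicator_of_notMem hx]; exact ⟨le_rfl, zero_le_one⟩
  -- The nearest point is strictly closer than R, so the restriction to the inner disc disappears in
  -- the limit.
  have hlt : ∀ᵐ ω ∂μ, ∀ u : ℕ → ℝ, Tendsto u atTop (𝓝 (bsDist X b₀ ω)) →
      ∀ᶠ n in atTop, X (b₁ ω) ω ∈ Metric.closedBall (0 : Plane) (u n) := by
    filter_upwards [hsec] with ω hω u hu
    filter_upwards [hu.eventually_const_lt (u := ‖X (b₁ ω) ω‖) hω.1] with n hn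
    simpa using hn.le
  refine setIntegral_eq_of_cells hR (hnet.ae_ne_zero.mono fun ω hω => hω _)
    (F := fun r _ ω => (Metric.closedBall 0 r).indicator
      (fun x : Plane => (1 + T * r ^ 4 / ‖x‖ ^ 4)⁻¹) (X (b₁ ω) ω))
    (G := fun r _ ω => (Metric.closedBall 0 r).indicator
      (fun _ : Plane => 1 - √T * Real.arctan (1 / √T)) (X (b₁ ω) ω))
    (fun r _ => ((hg r).indicator measurableSet_closedBall).comp hY)
    (fun r _ => (measurable_const.indicator measurableSet_closedBall).comp hY)
    (fun r _ ω => h01 r (fun x => ⟨by positivity, inv_le_one_of_one_le₀ ?_⟩) _)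
    (fun r _ ω => h01 r (fun x => ⟨hC0, hC1⟩) _) (fun r s hr hrs => ?_) ?_ ?_ hB
  · have : 0 ≤ T * r ^ 4 / ‖x‖ ^ 4 := by positivity
    linarith
  · rw [hnet.poisson.setIntegral_nearest hb₀ hb₁ hsec hrs.le (hg r),
      hnet.poisson.setIntegral_nearest hb₀ hb₁ hsec hrs.le measurable_const,
      Measure.restrict_smul, integral_smul_measure, integral_smul_measure,
      setIntegral_closedBall_inv_one_add hT hr, setIntegral_const]
    have hvol : (volume : Measure Plane).real (Metric.closedBall 0 r) = Real.pi * r ^ 2 := by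
      simp [Measure.real, hr, Real.pi_nonneg, mul_comm]
    rw [hvol, smul_eq_mul (Real.pi * r ^ 2)]
  · filter_upwards [hlt] with ω hω u v _ _ hu _
    have h1 : Tendsto (fun n => (1 + T * u n ^ 4 / ‖X (b₁ ω) ω‖ ^ 4)⁻¹) atTop
        (𝓝 (1 + T * bsDist X b₀ ω ^ 4 / ‖X (b₁ ω) ω‖ ^ 4)⁻¹) := by
      refine Tendsto.inv₀ ((((hu.pow 4).const_mul T).div_const _).const_add 1) ?_
      positivity
    refine h1.congr' ?_
    filter_upwards [hω u hu] with n hn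
    rw [Set.indicator_of_mem hn]
  · filter_upwards [hlt] with ω hω u v _ _ hu _
    refine tendsto_const_nhds.congr' ?_
    filter_upwards [hω u hu] with n hn
    rw [Set.indicator_of_mem hn]

/-- For measurability: each gain is only almost everywhere measurable, and a countable sum over the
possible indices handles the random one. -/
theorem skippedInterference_eq_tsum {Ω : Type*} (P η : ℝ) (X : ℕ → Ω → Plane) (h : ℕ → Ω → ℝ)
    (b : Ω → ℕ) (ω : Ω) : skippedInterference P η X h b ω =
      ∑' i, {ω | b ω = i}.indicator (fun ω => avgPower P η ‖X i ω‖ * h i ω) ω := by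
  rw [tsum_eq_single (b ω)]
  · rw [Set.indicator_of_mem (s := {ω' | b ω' = b ω}) rfl]; rfl
  · intro i hi
    exact Set.indicator_of_notMem (s := {ω' | b ω' = i}) (Ne.symm hi) _

theorem aemeasurable_skippedInterference (hnet : IsRayleighPoissonNetwork X h lam μ)
    (hb : Measurable b₁) : AEMeasurable (skippedInterference P 4 X h b₁) μ := by
  have : skippedInterference P 4 X h b₁ = fun ω =>
      ∑' i, {ω | b₁ ω = i}.indicator (fun ω => avgPower P 4 ‖X i ω‖ * h i ω) ω := by
    ext ω; exact skippedInterference_eq_tsum P 4 X h b₁ ω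
  rw [this]
  refine AEMeasurable.tsum fun i => AEMeasurable.indicator ?_ (hb (measurableSet_singleton i))
  exact (((hnet.poisson.measurable_point i).norm.pow_const _).const_mul P).aemeasurable.mul
    (hnet.gain_law i).aemeasurable

/-- The conditional Laplace transform of the interference from the skipped nearest point. -/
theorem IsRayleighPoissonNetwork.ae_condLaplace_skippedInterference [IsProbabilityMeasure μ]
    (hnet : IsRayleighPoissonNetwork X h lam μ) (hP : 0 < P) (hT : 0 < T)
    (hb₀ : Measurable b₀) (hb₁ : Measurable b₁)
    (hsec : ∀ᵐ ω ∂μ, IsSecondNearest (fun i => X i ω) (b₀ ω) (b₁ ω))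
    {β₀ β₁ : (ℕ → Plane) → ℕ} (hβ₀ : Measurable β₀) (hβ₁ : Measurable β₁)
    (hβb₀ : ∀ᵐ ω ∂μ, β₀ (fun i => X i ω) = b₀ ω) (hβb₁ : ∀ᵐ ω ∂μ, β₁ (fun i => X i ω) = b₁ ω) :
    ∀ᵐ ρ ∂(μ.map (bsDist X b₀)),
      condLaplace (skippedInterference P 4 X h b₁) (bsDist X b₀) μ (T * ρ ^ 4 / P) ρ =
        1 - √T * Real.arctan (1 / √T) := by
  have hX := hnet.poisson.measurable_point
  have hR : Measurable (bsDist X b₀) := (measurable_apply_index hX hb₀).norm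
  refine ae_condLaplace_eq (s := fun ρ => T * ρ ^ 4 / P)
    (aemeasurable_skippedInterference hnet hb₁) hR ?_ (by fun_prop)
    (fun r => by positivity) measurable_const (integrable_const _) fun B hB => ?_
  · filter_upwards [ae_nonneg_gains hnet.gain_law] with ω hω
    exact mul_nonneg (avgPower_nonneg hP.le (norm_nonneg _)) (hω _)
  · rw [← hnet.setIntegral_inv_one_add_nearest hT hb₀ hb₁ hsec hB]
    have hρ : Measurable fun x : ℕ → Plane => ‖x (β₀ x)‖ :=
      (measurable_apply_index (fun i => measurable_pi_apply i) hβ₀).norm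
    -- Weights concentrated on the skipped index, so that the general gain formula yields the single
    -- factor 1/(1 + T R⁴/r₁⁴).
    set c : (ℕ → Plane) → ℕ → ℝ := fun x i =>
      {x | β₁ x = i}.indicator (fun x => T * ‖x (β₀ x)‖ ^ 4 / ‖x i‖ ^ 4) x with hc
    have hc0 : ∀ x i, i ≠ β₁ x → c x i = 0 := fun x i hi =>
      Set.indicator_of_notMem (s := {x | β₁ x = i}) (Ne.symm hi) _
    have hc1 : ∀ x, c x (β₁ x) = T * ‖x (β₀ x)‖ ^ 4 / ‖x (β₁ x)‖ ^ 4 := fun x =>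
      Set.indicator_of_mem (s := {y | β₁ y = β₁ x}) rfl
        fun y => T * ‖y (β₀ y)‖ ^ 4 / ‖y (β₁ x)‖ ^ 4
    have hRρ : ∀ᵐ ω ∂μ, ‖X (β₀ fun i => X i ω) ω‖ = bsDist X b₀ ω := by
      filter_upwards [hβb₀] with ω hω
      rw [hω, bsDist]
    have key := setIntegral_exp_neg_tsum_gains (ξ := fun ω i => X i ω) (measurable_pi_iff.2 hX)
      hnet.gain_law hnet.gain_indep hnet.gain_indep_points (c := c)
      (fun i => Measurable.indicator (((hρ.pow_const 4).const_mul T).div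
        ((measurable_pi_apply i).norm.pow_const 4)) (hβ₁ (measurableSet_singleton i)))
      (fun x i => Set.indicator_nonneg (fun _ _ => by positivity) _) ?_
      (E := (fun x => ‖x (β₀ x)‖) ⁻¹' B) (hρ hB)
    · have hpre : (fun ω i => X i ω) ⁻¹' ((fun x : ℕ → Plane => ‖x (β₀ x)‖) ⁻¹' B) =ᵐ[μ]
          bsDist X b₀ ⁻¹' B := by
        filter_upwards [hRρ] with ω hω
        change (‖X (β₀ fun i => X i ω) ω‖ ∈ B) = (bsDist X b₀ ω ∈ B)
        rw [hω]
      rw [setIntegral_congr_set hpre, setIntegral_congr_set hpre] at key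
      refine Eq.trans (Eq.trans ?_ key) ?_
      · refine integral_congr_ae (ae_restrict_of_ae ?_)
        filter_upwards [hRρ, hβb₁] with ω hω hω₁
        rw [tsum_eq_single (β₁ fun i => X i ω) fun i hi => by rw [hc0 _ _ hi, zero_mul], hc1, hω₁,
          hω, skippedInterference, show bsDist X b₁ ω = ‖X (b₁ ω) ω‖ from rfl,
          mul_avgPower_mul hP.ne' _ _ _ _ (norm_nonneg _)]
      · refine integral_congr_ae (ae_restrict_of_ae ?_)
        filter_upwards [hRρ, hβb₁] with ω hω hω₁
        rw [tsum_eq_single (β₁ fun i => X i ω) fun i hi => by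
          rw [hc0 _ _ hi, add_zero, Real.log_one], hc1, hω₁, hω, Real.exp_neg, Real.exp_log]
        positivity
    · refine .of_forall fun ω => summable_of_ne_finset_zero (s := {β₁ fun i => X i ω}) ?_
      intro i hi
      exact hc0 _ _ (by simpa using hi)

end Skipped

/-! ### The best connected and blackout cases. -/

theorem corollary2 {Ω : Type*} [MeasurableSpace Ω] (μ : Measure Ω) [IsProbabilityMeasure μ]
    (lam P T : ℝ) (hlam : 0 < lam) (hP : 0 < P) (hT : 0 < T)
    (X : ℕ → Ω → Plane) (h : ℕ → Ω → ℝ) (hnet : IsRayleighPoissonNetwork X h lam μ) :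
    (∀ b₀ : Ω → ℕ, IsBestConnected P 4 X b₀ μ →
      (∀ᵐ ω ∂μ, Summable (outerTerm P 4 X h (bsDist X b₀) ω)) ∧
      ∀ᵐ ρ ∂(μ.map (bsDist X b₀)),
        condLaplace (outerInterference P 4 X h (bsDist X b₀)) (bsDist X b₀) μ (T * ρ ^ 4 / P) ρ =
          Real.exp (-(Real.pi * lam * ρ ^ 2 * (√T * Real.arctan √T)))) ∧
    (∀ b₀ b₁ : Ω → ℕ, IsBlackout P 4 X b₀ b₁ μ →
      (∀ᵐ ω ∂μ, Summable (outerTerm P 4 X h (bsDist X b₀) ω)) ∧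
      (∀ᵐ ρ ∂(μ.map (bsDist X b₀)),
        condLaplace (outerInterference P 4 X h (bsDist X b₀)) (bsDist X b₀) μ (T * ρ ^ 4 / P) ρ =
          Real.exp (-(Real.pi * lam * ρ ^ 2 * (√T * Real.arctan √T)))) ∧
      ∀ᵐ ρ ∂(μ.map (bsDist X b₀)),
        condLaplace (skippedInterference P 4 X h b₁) (bsDist X b₀) μ (T * ρ ^ 4 / P) ρ =
          1 - √T * Real.arctan (1 / √T)) := by
  have hsummable : ∀ b₀ : Ω → ℕ, ∀ᵐ ω ∂μ, Summable (outerTerm P 4 X h (bsDist X b₀) ω) :=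
    fun b₀ => hnet.ae_summable_outerTerm P (hnet.ae_ne_zero.mono fun ω hω => hω _)
  refine ⟨fun b₀ hb => ⟨hsummable b₀, ?_⟩, fun b₀ b₁ hb => ⟨hsummable b₀, ?_⟩⟩
  · have hnear := hb.ae_isNearest hnet hP
    have hcount : ∀ᵐ ω ∂μ, ∀ r, bsDist X b₀ ω ≤ r ↔
        0 < pointCount (fun i => X i ω) (Metric.closedBall 0 r) := by
      filter_upwards [hnear] with ω hω r
      exact hω.norm_le_iff r
    obtain ⟨β, hβ, hβb⟩ := exists_measurable_nearest_index hnear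
    exact hnet.ae_condLaplace_outerInterference hlam hP hT hb.1 hcount hβ hβb
  · have hsec := hb.ae_isSecondNearest hnet hP
    -- The two cases differ for the outer interference only in this threshold, 1 instead of 0, which
    -- does not enter the value.
    have hcount : ∀ᵐ ω ∂μ, ∀ r, bsDist X b₀ ω ≤ r ↔
        1 < pointCount (fun i => X i ω) (Metric.closedBall 0 r) := by
      filter_upwards [hsec] with ω hω r
      exact hω.norm_le_iff r
    obtain ⟨β₁, hβ₁, hβb₁⟩ := exists_measurable_nearest_index (hsec.mono fun _ h => h.isNearest)
    obtain ⟨β₀, hβ₀, hβb₀⟩ := exists_measurable_secondNearest_index hsec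
    exact ⟨hnet.ae_condLaplace_outerInterference hlam hP hT hb.1 hcount hβ₀ hβb₀,
      hnet.ae_condLaplace_skippedInterference hP hT hb.1 hb.2.1 hsec hβ₀ hβ₁ hβb₀ hβb₁⟩
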